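/- Let $\mathbb K$ be a field of characteristic zero and let $\Omega=\bigoplus_{i\le 0}\Omega_i$ be a nonpositively graded, unital, graded commutative differential graded $\mathbb K$-algebra with differential $d$ of degree $-1$. Assume that $\Omega$ is simply connected, that is, $H_0(\Omega)=\mathbb K$ and $H_{-1}(\Omega)=0$, and that $\Omega$ is locally finite, that is, every $H_i(\Omega)$ is finite dimensional. Let $C(\Omega)=\bigoplus_{k\ge 0}\Omega\otimes\overline\Omega^{\otimes k}$, where $\overline\Omega=\Omega/\mathbb K$, be the normalised cyclic bar complex of $\Omega$, graded by $\deg(w_0,\dots,w_k)=\deg w_0+\dots+\deg w_k+k$. With $\epsilon_i=\deg w_0+\dots+\deg w_i-i$ (so $\epsilon_{-1}=1$), its operators $b$ of degree $-1$ and $B$ of degree $+1$ are $$b(w_0,\dots,w_k)=-\sum_{i=0}^{k}(-1)^{\epsilon_{i-1}}(w_0,\dots,dw_i,\dots,w_k)-\sum_{i=0}^{k-1}(-1)^{\epsilon_i}(w_0,\dots,w_iw_{i+1},\dots,w_k)+(-1)^{(\deg w_k-1)\epsilon_{k-1}}(w_kw_0,w_1,\dots,w_{k-1}),$$ $$B(w_0,\dots,w_k)=\sum_{i=0}^{k}(-1)^{(\epsilon_{i-1}+1)(\epsilon_k-\epsilon_{i-1})}(1,w_i,\dots,w_k,w_0,\dots,w_{i-1}),$$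 where the last term of $b$ is absent for $k=0$; they satisfy $b^2=B^2=bB+Bb=0$. Let $\widetilde C(\Omega)=C(\Omega)/C(\mathbb K)$ be the reduced complex, where $C(\mathbb K)=\mathbb K\cdot(1)$. The reduced Hochschild homology $\widetilde{HH}_*(\Omega)$ is the homology of $(\widetilde C(\Omega),b)$. The reduced negative cyclic homology $\widetilde{HC}{}^-_*(\Omega)$ is the homology of $(\widetilde C(\Omega)[[u]],\,b+uB)$ with $\deg u=-2$, where $\widetilde C(\Omega)[[u]]$ consists in degree $n$ of the power series $\sum_{i\ge 0}x_iu^i$ with $x_i\in\widetilde C(\Omega)_{n+2i}$. The reduced $S$-action is the multiplication by $u$, $S\colon\widetilde{HC}{}^-_{n+2}(\Omega)\to\widetilde{HC}{}^-_n(\Omega)$. Let $\pi\colon\widetilde{HC}{}^-_n(\Omega)\to\widetilde{HH}_n(\Omega)$ be the map induced by $u\mapsto 0$, let $\beta\colon\widetilde{HH}_n(\Omega)\to\widetilde{HC}{}^-_{n+1}(\Omega)$ be the map $[x]\mapsto[Bx]$, and let $\widetilde B=\pi\circ\beta\colon\widetilde{HH}_*(\Omega)\to\widetilde{HH}_{*+1}(\Omega)$.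 The algebra $\Omega$ is called Batalin--Vilkovisky (BV) exact if $\operatorname{Im}\widetilde B=\ker\widetilde B$. Then $\Omega$ is BV exact if and only if the reduced $S$-action is trivial, that is, $S\colon\widetilde{HC}{}^-_{n+2}(\Omega)\to\widetilde{HC}{}^-_n(\Omega)$ is zero for every $n\in\mathbb Z$. -/

import Mathlib

open scoped DirectSum TensorProduct

/-- A nonpositively graded commutative chain DGA structure on the graded `K`-algebra
`A = ⨁ 𝒜 i`: a differential of degree `-1`. -/
structure NonposCDGA {K : Type*} [Field K] {A : Type*} [Ring A] [Algebra K A]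
    (𝒜 : ℤ → Submodule K A) [GradedAlgebra 𝒜] where
  /-- the differential -/
  d : A →ₗ[K] A
  d_mem : ∀ {i : ℤ} {a : A}, a ∈ 𝒜 i → d a ∈ 𝒜 (i - 1)
  d_d : ∀ a : A, d (d a) = 0
  leibniz : ∀ {i : ℤ} {a : A} (b : A), a ∈ 𝒜 i →
    d (a * b) = d a * b + (i.negOnePow : ℤ) • (a * d b)
  graded_comm : ∀ {i j : ℤ} {a b : A}, a ∈ 𝒜 i → b ∈ 𝒜 j →
    a * b = ((i * j).negOnePow : ℤ) • (b * a)
  nonpos : ∀ {i : ℤ}, 0 < i → 𝒜 i = ⊥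

namespace CyclicBar

/-- The sign `(-1)^x` for a parity `x`. -/
def sgn (x : ZMod 2) : ℤ := if x = 0 then 1 else -1

/-! ### Parity in a graded algebra -/

section Parity

variable {K : Type*} [Field K] {A : Type*} [Ring A] [Algebra K A]
variable (𝒜 : ℤ → Submodule K A) [GradedAlgebra 𝒜]

/-- The projection of `A` onto the sum of the `𝒜 i` with `i ≡ p` modulo 2. -/
noncomputable def parityPart (p : ZMod 2) : A →ₗ[K] A :=
  (DirectSum.decomposeLinearEquiv 𝒜).symm.toLinearMap ∘ₗ
    DFinsupp.filterLinearMap K (fun i => 𝒜 i) (fun i : ℤ => (i : ZMod 2) = p) ∘ₗ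
      (DirectSum.decomposeLinearEquiv 𝒜).toLinearMap

/-- The multilinear map with `(w₀, …) ↦ (-1)^(s (deg w₀, …)) f (w₀, …)` on homogeneous letters,
for a sign exponent `s` that depends on the parities of the degrees. -/
noncomputable def koszul {M : Type*} [AddCommGroup M] [Module K M] {n : ℕ}
    (s : (Fin n → ZMod 2) → ZMod 2) (f : MultilinearMap K (fun _ : Fin n => A) M) :
    MultilinearMap K (fun _ : Fin n => A) M :=
  ∑ p : Fin n → ZMod 2, sgn (s p) • f.compLinearMap (fun j => parityPart 𝒜 (p j))

end Parity

/-! ### The cyclic bar complex -/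

section Chains

variable (K : Type*) [Field K] (A : Type*) [Ring A] [Algebra K A]

/-- Unnormalised chains `⨁ₖ A^{⊗(k+1)}`. -/
def Un : Type _ := ⨁ k : ℕ, ⨂[K] (_ : Fin (k + 1)), A

noncomputable instance : AddCommGroup (Un K A) :=
  inferInstanceAs (AddCommGroup (⨁ k : ℕ, ⨂[K] (_ : Fin (k + 1)), A))

noncomputable instance : Module K (Un K A) :=
  inferInstanceAs (Module K (⨁ k : ℕ, ⨂[K] (_ : Fin (k + 1)), A))

/-- The elementary chain `(w₀, …, wₖ)`, multilinear in the letters. -/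
noncomputable def word (k : ℕ) : MultilinearMap K (fun _ : Fin (k + 1) => A) (Un K A) :=
  LinearMap.compMultilinearMap (M₂ := ⨂[K] (_ : Fin (k + 1)), A) (M₃ := Un K A)
    (DirectSum.lof K ℕ (fun k : ℕ => ⨂[K] (_ : Fin (k + 1)), A) k) (PiTensorProduct.tprod K)

variable {K A} in
/-- The linear map on unnormalised chains with given multilinear values on elementary chains. -/
noncomputable def liftUn {M : Type*} [AddCommGroup M] [Module K M]
    (f : ∀ k : ℕ, MultilinearMap K (fun _ : Fin (k + 1) => A) M) : Un K A →ₗ[K] M :=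
  DirectSum.toModule K ℕ M fun k => PiTensorProduct.lift (f k)

variable {K A} in
lemma liftUn_word {M : Type*} [AddCommGroup M] [Module K M]
    (f : ∀ k : ℕ, MultilinearMap K (fun _ : Fin (k + 1) => A) M) (k : ℕ) (w : Fin (k + 1) → A) :
    liftUn f (word K A k w) = f k w := by
  refine (DirectSum.toModule_lof K (M := fun k : ℕ => ⨂[K] (_ : Fin (k + 1)), A) k
    (PiTensorProduct.tprod K w)).trans ?_
  exact PiTensorProduct.lift.tprod w

variable {K A} in
lemma linearMap_ext_word {M : Type*} [AddCommGroup M] [Module K M] {f g : Un K A →ₗ[K] M}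
    (h : ∀ k w, f (word K A k w) = g (word K A k w)) : f = g :=
  DirectSum.linearMap_ext K (M := fun k : ℕ => ⨂[K] (_ : Fin (k + 1)), A) fun k =>
    PiTensorProduct.ext (MultilinearMap.ext fun w => h k w)

/-- The degenerate chains, spanned by the `(w₀, …, wₖ)` with `wⱼ = 1` for some `j ≥ 1`. -/
noncomputable def degen : Submodule K (Un K A) :=
  Submodule.span K {x | ∃ (k : ℕ) (w : Fin (k + 1) → A) (j : Fin (k + 1)),
    j ≠ 0 ∧ w j = 1 ∧ x = word K A k w}

/-- The normalised chains `C(A) = ⨁ₖ A ⊗ (A/K)^{⊗k}`, realised as the quotient of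
`⨁ₖ A ⊗ A^{⊗k}` by the degenerate chains. -/
abbrev Chains : Type _ := Un K A ⧸ degen K A

variable {K A}

lemma contractNth_update (k : ℕ)
    (i : Fin (k + 1)) (w : Fin (k + 2) → A) (c : Fin (k + 2)) :
    ∃ (c' : Fin (k + 1)) (φ : A →ₗ[K] A), ∀ x : A,
      Fin.contractNth i.castSucc (· * ·) (Function.update w c x) =
        Function.update (Fin.contractNth i.castSucc (· * ·) w) c' (φ x) := by
  obtain ⟨i, hi⟩ := i
  obtain ⟨c, hc⟩ := c
  rcases lt_trichotomy c i with h | h | h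
  · refine ⟨⟨c, by omega⟩, LinearMap.id, fun x => funext fun ⟨j, hj⟩ => ?_⟩
    simp only [Fin.contractNth, Function.update_apply, Fin.ext_iff, Fin.val_castSucc, Fin.val_succ,
      LinearMap.id_apply]
    split_ifs <;> first | rfl | omega
  · refine ⟨⟨c, by omega⟩, LinearMap.mulRight K (w ⟨c + 1, by omega⟩),
      fun x => funext fun ⟨j, hj⟩ => ?_⟩
    simp only [Fin.contractNth, Function.update_apply, Fin.ext_iff, Fin.val_castSucc, Fin.val_succ,
      LinearMap.mulRight_apply]
    split_ifs <;> first | rfl | omega | (congr 2; simp [Fin.ext_iff]; omega)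
  · rcases Nat.lt_or_ge (i + 1) c with h' | h'
    · refine ⟨⟨c - 1, by omega⟩, LinearMap.id, fun x => funext fun ⟨j, hj⟩ => ?_⟩
      simp only [Fin.contractNth, Function.update_apply, Fin.ext_iff, Fin.val_castSucc,
        Fin.val_succ, LinearMap.id_apply]
      split_ifs <;> first | rfl | omega
    · refine ⟨⟨i, by omega⟩, LinearMap.mulLeft K (w ⟨i, by omega⟩),
        fun x => funext fun ⟨j, hj⟩ => ?_⟩
      simp only [Fin.contractNth, Function.update_apply, Fin.ext_iff, Fin.val_castSucc,
        Fin.val_succ, LinearMap.mulLeft_apply]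
      split_ifs <;> first | rfl | omega | (congr 2; simp [Fin.ext_iff]; omega)

variable (K A) in
/-- `(w₀, …, w_{k+1}) ↦ (w₀, …, wᵢ wᵢ₊₁, …, w_{k+1})`. -/
noncomputable def mulAt (k : ℕ) (i : Fin (k + 1)) :
    MultilinearMap K (fun _ : Fin (k + 2) => A) (Un K A) where
  toFun w := word K A k (Fin.contractNth i.castSucc (· * ·) w)
  map_update_add' := by
    intro inst w c x y
    obtain rfl := Subsingleton.elim inst (instDecidableEqFin (k + 2))
    obtain ⟨c', φ, h⟩ := contractNth_update (K := K) k i w c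
    simp only [h, map_add, MultilinearMap.map_update_add]
  map_update_smul' := by
    intro inst w c r x
    obtain rfl := Subsingleton.elim inst (instDecidableEqFin (k + 2))
    obtain ⟨c', φ, h⟩ := contractNth_update (K := K) k i w c
    simp only [h, map_smul, MultilinearMap.map_update_smul]

variable (K A) in
/-- `(w₀, …, w_{k+1}) ↦ (w_{k+1} w₀, w₁, …, w_k)`: rotate the last letter to the front and
multiply it with its neighbour. -/
noncomputable def mulLast (k : ℕ) : MultilinearMap K (fun _ : Fin (k + 2) => A) (Un K A) :=
  (mulAt K A k 0).domDomCongr (Equiv.addLeft (Fin.last (k + 1)))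

variable (K A) in
/-- `(w₀, …, wₖ) ↦ (1, wᵢ, …, wₖ, w₀, …, wᵢ₋₁)`. -/
noncomputable def rotate (k : ℕ) (i : Fin (k + 1)) :
    MultilinearMap K (fun _ : Fin (k + 1) => A) (Un K A) :=
  ((word K A (k + 1)).curryLeft 1).domDomCongr (Equiv.addLeft i)

/-- `(w₀, …, wₖ) ↦ (w₀, …, d wᵢ, …, wₖ)`. -/
noncomputable def diffAt (d : A →ₗ[K] A) (k : ℕ) (i : Fin (k + 1)) :
    MultilinearMap K (fun _ : Fin (k + 1) => A) (Un K A) :=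
  (word K A k).compLinearMap (fun j => if j = i then d else LinearMap.id)

/-- The parity of `εᵢ = deg w₀ + ⋯ + deg wᵢ - i`, for `-1 ≤ i`. -/
def eps {n : ℕ} (p : Fin n → ZMod 2) (i : ℤ) : ZMod 2 :=
  (∑ j ∈ Finset.univ.filter (fun j : Fin n => ((j : ℕ) : ℤ) ≤ i), p j) - (i : ZMod 2)

variable (𝒜 : ℤ → Submodule K A)

/-- The unnormalised chains of degree `n`: the span of the `(w₀, …, wₖ)` with homogeneous letters
and `deg w₀ + ⋯ + deg wₖ + k = n`. -/
noncomputable def unGr (n : ℤ) : Submodule K (Un K A) :=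
  Submodule.span K {x | ∃ (k : ℕ) (w : Fin (k + 1) → A) (e : Fin (k + 1) → ℤ),
    (∀ j, w j ∈ 𝒜 (e j)) ∧ ∑ j, e j + k = n ∧ x = word K A k w}

variable [GradedAlgebra 𝒜]

/-- The part of the Hochschild differential that comes from the differential of the algebra:
`(w₀, …, wₖ) ↦ -∑ᵢ (-1)^{εᵢ₋₁} (w₀, …, d wᵢ, …, wₖ)`. -/
noncomputable def bDiff (d : A →ₗ[K] A) : Un K A →ₗ[K] Un K A :=
  liftUn fun k =>
    -∑ i : Fin (k + 1), koszul 𝒜 (fun p => eps p (i - 1)) (diffAt d k i)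

/-- The part of the Hochschild differential that comes from the product of the algebra:
`(w₀, …, wₖ) ↦ -∑_{0 ≤ i < k} (-1)^{εᵢ} (w₀, …, wᵢ wᵢ₊₁, …, wₖ)
  + (-1)^{(deg wₖ - 1) εₖ₋₁} (wₖ w₀, w₁, …, wₖ₋₁)`, and `0` on chains `(w₀)`. -/
noncomputable def bMul : Un K A →ₗ[K] Un K A :=
  liftUn fun k => match k with
    | 0 => 0
    | k + 1 => -∑ i : Fin (k + 1), koszul 𝒜 (fun p => eps p i) (mulAt K A k i)
        + koszul 𝒜 (fun p => (p (Fin.last (k + 1)) - 1) * eps p k) (mulLast K A k)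

/-- The Hochschild differential `b` on unnormalised chains. -/
noncomputable def bUn (d : A →ₗ[K] A) : Un K A →ₗ[K] Un K A := bDiff 𝒜 d + bMul 𝒜

/-- Connes' operator
`(w₀, …, wₖ) ↦ ∑ᵢ (-1)^{(εᵢ₋₁ + 1)(εₖ - εᵢ₋₁)} (1, wᵢ, …, wₖ, w₀, …, wᵢ₋₁)`. -/
noncomputable def BUn : Un K A →ₗ[K] Un K A :=
  liftUn fun k =>
    ∑ i : Fin (k + 1), koszul 𝒜 (fun p => (eps p (i - 1) + 1) * (eps p k - eps p (i - 1)))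
      (rotate K A k i)

end Chains

/-! ### Parity lemmas -/

section ParityLemmas

variable {K : Type*} [Field K] {A : Type*} [Ring A] [Algebra K A]
variable (𝒜 : ℤ → Submodule K A)

lemma sgn_add (x y : ZMod 2) : sgn (x + y) = sgn x * sgn y := by
  revert x y; decide

lemma sgn_intCast (i : ℤ) : sgn (i : ZMod 2) = i.negOnePow := by
  rcases Int.even_or_odd i with h | h
  · rw [Int.negOnePow_even i h, (ZMod.intCast_zmod_eq_zero_iff_dvd i 2).2 h.two_dvd]; rfl
  · obtain ⟨m, rfl⟩ := h
    rw [Int.negOnePow_odd _ ⟨m, rfl⟩]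
    have : ((2 * m + 1 : ℤ) : ZMod 2) = 1 := by
      push_cast; rw [show (2 : ZMod 2) = 0 from rfl]; simp
    rw [this]; rfl

/-- The elements of parity `p`. -/
def parity (p : ZMod 2) : Submodule K A :=
  Submodule.span K {a | ∃ i : ℤ, (i : ZMod 2) = p ∧ a ∈ 𝒜 i}

variable {𝒜}

lemma mem_parity {i : ℤ} {a : A} (h : a ∈ 𝒜 i) : a ∈ parity 𝒜 (i : ZMod 2) :=
  Submodule.subset_span ⟨i, rfl, h⟩

variable [GradedAlgebra 𝒜]

lemma parityPart_of_mem {p : ZMod 2} {a : A} (h : a ∈ parity 𝒜 p) (p' : ZMod 2) :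
    parityPart 𝒜 p' a = if p' = p then a else 0 := by
  induction h using Submodule.span_induction with
  | mem a h =>
    obtain ⟨i, hi, ha⟩ := h
    have h1 : parityPart 𝒜 p' a = (DirectSum.decompose 𝒜).symm
        (DFinsupp.filter (fun i : ℤ => (i : ZMod 2) = p') (DirectSum.decompose 𝒜 a)) := rfl
    have h2 : DirectSum.decompose 𝒜 a = DFinsupp.single i ⟨a, ha⟩ :=
      DirectSum.decompose_of_mem 𝒜 ha
    rw [h1, h2, DFinsupp.filter_single, hi]
    by_cases h : p' = p
    · rw [if_pos h.symm, if_pos h, ← h2, Equiv.symm_apply_apply]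
    · rw [if_neg (Ne.symm h), if_neg h]; exact DirectSum.decompose_symm_zero 𝒜
  | zero => simp
  | add a b _ _ ha hb => rw [map_add, ha, hb]; split_ifs <;> simp
  | smul c a _ ha => rw [map_smul, ha]; split_ifs <;> simp

lemma parityPart_homog (p : ZMod 2) {i : ℤ} {a : A} (ha : a ∈ 𝒜 i) :
    parityPart 𝒜 p a = if p = i then a else 0 := parityPart_of_mem (mem_parity ha) p

lemma parityPart_mem (p : ZMod 2) (a : A) : parityPart 𝒜 p a ∈ parity 𝒜 p := by
  induction a using DirectSum.Decomposition.inductionOn 𝒜 with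
  | zero => simp
  | @homogeneous i m =>
    rw [parityPart_homog p m.2]
    split_ifs with h
    · rw [h]; exact mem_parity m.2
    · simp
  | add a b ha hb => rw [map_add]; exact add_mem ha hb

lemma sum_parityPart (a : A) : ∑ p, parityPart 𝒜 p a = a := by
  induction a using DirectSum.Decomposition.inductionOn 𝒜 with
  | zero => simp
  | @homogeneous i m => simp [parityPart_homog _ m.2]
  | add a b ha hb => simp only [map_add, Finset.sum_add_distrib, ha, hb]

lemma mul_mem_parity {p p' : ZMod 2} {a b : A} (ha : a ∈ parity 𝒜 p) (hb : b ∈ parity 𝒜 p') :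
    a * b ∈ parity 𝒜 (p + p') := by
  induction ha using Submodule.span_induction with
  | mem a h =>
    obtain ⟨i, rfl, ha⟩ := h
    induction hb using Submodule.span_induction with
    | mem b h =>
      obtain ⟨j, rfl, hb⟩ := h
      have := mem_parity (SetLike.mul_mem_graded ha hb)
      rwa [Int.cast_add] at this
    | zero => simp
    | add x y _ _ hx hy => rw [mul_add]; exact add_mem hx hy
    | smul c x _ hx => rw [mul_smul_comm]; exact Submodule.smul_mem _ _ hx
  | zero => simp
  | add x y _ _ hx hy => rw [add_mul]; exact add_mem hx hy
  | smul c x _ hx => rw [smul_mul_assoc]; exact Submodule.smul_mem _ _ hx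

lemma one_mem_parity : (1 : A) ∈ parity 𝒜 0 := by
  have := mem_parity (𝒜 := 𝒜) (SetLike.one_mem_graded 𝒜)
  rwa [Int.cast_zero] at this

lemma d_mem_parity (Ω : NonposCDGA 𝒜) {p : ZMod 2} {a : A} (ha : a ∈ parity 𝒜 p) :
    Ω.d a ∈ parity 𝒜 (p + 1) := by
  induction ha using Submodule.span_induction with
  | mem a h =>
    obtain ⟨i, rfl, ha⟩ := h
    have := mem_parity (Ω.d_mem ha)
    rwa [Int.cast_sub, Int.cast_one, sub_eq_add_neg, show (-1 : ZMod 2) = 1 from rfl] at this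
  | zero => simp
  | add x y _ _ hx hy => rw [map_add]; exact add_mem hx hy
  | smul c x _ hx => rw [map_smul]; exact Submodule.smul_mem _ _ hx

lemma leibniz_parity (Ω : NonposCDGA 𝒜) {p : ZMod 2} {a : A} (b : A) (ha : a ∈ parity 𝒜 p) :
    Ω.d (a * b) = Ω.d a * b + sgn p • (a * Ω.d b) := by
  induction ha using Submodule.span_induction with
  | mem a h =>
    obtain ⟨i, rfl, ha⟩ := h
    rw [sgn_intCast]; exact Ω.leibniz b ha
  | zero => simp
  | add x y _ _ hx hy => simp only [add_mul, map_add, hx, hy, smul_add]; abel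
  | smul c x _ hx =>
    simp only [smul_mul_assoc, map_smul, hx, smul_add]
    rw [smul_comm c (sgn p)]

lemma d_one (Ω : NonposCDGA 𝒜) : Ω.d 1 = 0 := by
  have := Ω.leibniz 1 (SetLike.one_mem_graded 𝒜)
  simpa using this

lemma koszul_apply {M : Type*} [AddCommGroup M] [Module K M] {n : ℕ}
    (s : (Fin n → ZMod 2) → ZMod 2) (f : MultilinearMap K (fun _ : Fin n => A) M)
    (w : Fin n → A) (q : Fin n → ZMod 2) (hw : ∀ j, w j ∈ parity 𝒜 (q j)) :
    koszul 𝒜 s f w = sgn (s q) • f w := by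
  rw [koszul, sum_apply, Finset.sum_eq_single q]
  · rw [smul_apply, MultilinearMap.compLinearMap_apply]
    congr 2; funext j; rw [parityPart_of_mem (hw j), if_pos rfl]
  · intro p _ hp
    obtain ⟨j, hj⟩ := Function.ne_iff.1 hp
    rw [smul_apply, MultilinearMap.compLinearMap_apply,
      f.map_coord_zero j (by rw [parityPart_of_mem (hw j), if_neg hj]), smul_zero]
  · simp

lemma multilinear_eq_sum {M : Type*} [AddCommGroup M] [Module K M] {n : ℕ}
    (f : MultilinearMap K (fun _ : Fin n => A) M) (w : Fin n → A) :
    f w = ∑ p : Fin n → ZMod 2, f (fun j => parityPart 𝒜 (p j) (w j)) := by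
  rw [← MultilinearMap.map_sum f (fun j p => parityPart 𝒜 p (w j))]
  congr 1; funext j; exact (sum_parityPart (w j)).symm

end ParityLemmas

/-! ### Formulas on homogeneous chains -/

section Formulas

variable {K : Type*} [Field K] {A : Type*} [Ring A] [Algebra K A]

variable (K) in
/-- The chain `(w 0, …, w k)` for a sequence of letters. -/
noncomputable def natWord (k : ℕ) (w : ℕ → A) : Un K A := word K A k (fun j => w j)

/-- The parity of `ε_{i-1}` for a sequence of parities. -/
def natEps (q : ℕ → ZMod 2) (i : ℕ) : ZMod 2 := ∑ j ∈ Finset.range i, q j + i + 1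

lemma eps_eq (q : ℕ → ZMod 2) {n i : ℕ} (h : i ≤ n) :
    eps (fun j : Fin n => q j) ((i : ℤ) - 1) = natEps q i := by
  rw [eps, natEps, Finset.sum_filter,
    Fin.sum_univ_eq_sum_range (fun j => if ((j : ℕ) : ℤ) ≤ (i : ℤ) - 1 then q j else 0) n,
    ← Finset.sum_filter]
  have : (Finset.range n).filter (fun j : ℕ => (j : ℤ) ≤ (i : ℤ) - 1) = Finset.range i := by
    ext j; simp only [Finset.mem_filter, Finset.mem_range]; omega
  rw [this]
  push_cast
  rw [sub_sub_eq_add_sub, add_sub_right_comm, sub_eq_add_neg, ZMod.neg_eq_self_mod_two,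
    add_right_comm]

lemma eps_eq' (q : ℕ → ZMod 2) {n i : ℕ} (h : i + 1 ≤ n) :
    eps (fun j : Fin n => q j) (i : ℤ) = natEps q (i + 1) := by
  rw [← eps_eq q h]; congr 1; push_cast; ring

/-- Merge the letters `i` and `i + 1`. -/
def merge {R : Type*} (op : R → R → R) (i : ℕ) (w : ℕ → R) : ℕ → R :=
  fun j => if j < i then w j else if j = i then op (w i) (w (i + 1)) else w (j + 1)

/-- Merge the letter `k` with the letter `0`. -/
def mergeLast {R : Type*} (op : R → R → R) (k : ℕ) (w : ℕ → R) : ℕ → R :=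
  fun j => if j = 0 then op (w k) (w 0) else w j

/-- The cyclic rotation of `(w 0, …, w k)` that starts with `w i`, with `e` put in front. -/
def rot {R : Type*} (e : R) (k i : ℕ) (w : ℕ → R) : ℕ → R :=
  fun j => if j = 0 then e else
    if i + j ≤ k + 1 then w (i + j - 1) else w (i + j - 1 - (k + 1))

lemma natWord_congr {k : ℕ} {w w' : ℕ → A} (h : ∀ j ≤ k, w j = w' j) :
    natWord K k w = natWord K k w' := by
  rw [natWord, natWord]; congr 1; funext j; exact h _ (by omega)

lemma natWord_eq_zero {k : ℕ} {w : ℕ → A} {j : ℕ} (hj : j ≤ k) (h : w j = 0) :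
    natWord K k w = 0 :=
  (word K A k).map_coord_zero ⟨j, by omega⟩ h

lemma natWord_mem_degen {k : ℕ} {w : ℕ → A} {j : ℕ} (hj : j ≤ k) (h0 : j ≠ 0) (h : w j = 1) :
    natWord K k w ∈ degen K A :=
  Submodule.subset_span ⟨k, _, ⟨j, by omega⟩, by simpa [Fin.ext_iff] using h0, h, rfl⟩

lemma natWord_add {k : ℕ} {w w' w'' : ℕ → A} {j : ℕ} (hj : j ≤ k) (h : w j = w' j + w'' j)
    (h1 : ∀ i ≤ k, i ≠ j → w i = w' i) (h2 : ∀ i ≤ k, i ≠ j → w i = w'' i) :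
    natWord K k w = natWord K k w' + natWord K k w'' := by
  have key : ∀ v : ℕ → A, (∀ i ≤ k, i ≠ j → w i = v i) →
      (fun i : Fin (k + 1) => v i) =
        Function.update (fun i : Fin (k + 1) => w i) ⟨j, by omega⟩ (v j) := by
    intro v hv
    funext i
    rw [Function.update_apply]
    split_ifs with hi
    · rw [hi]
    · exact (hv i (by omega) (by simpa [Fin.ext_iff] using hi)).symm
  rw [natWord, natWord, natWord, key w (fun _ _ _ => rfl), key w' h1, key w'' h2, h,
    MultilinearMap.map_update_add]

lemma natWord_zsmul {k : ℕ} {w w' : ℕ → A} {j : ℕ} (hj : j ≤ k) (c : ℤ) (h : w j = c • w' j)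
    (h1 : ∀ i ≤ k, i ≠ j → w i = w' i) :
    natWord K k w = c • natWord K k w' := by
  have key : ∀ v : ℕ → A, (∀ i ≤ k, i ≠ j → w i = v i) →
      (fun i : Fin (k + 1) => v i) =
        Function.update (fun i : Fin (k + 1) => w i) ⟨j, by omega⟩ (v j) := by
    intro v hv
    funext i
    rw [Function.update_apply]
    split_ifs with hi
    · rw [hi]
    · exact (hv i (by omega) (by simpa [Fin.ext_iff] using hi)).symm
  rw [natWord, natWord, key w (fun _ _ _ => rfl), key w' h1, h]
  have := (word K A k).map_update_smul (fun i : Fin (k + 1) => w i) ⟨j, by omega⟩ (c : K) (w' j)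
  rwa [Int.cast_smul_eq_zsmul, Int.cast_smul_eq_zsmul] at this

/-- A finite word as a sequence of letters. -/
def extend {R : Type*} {k : ℕ} (v : Fin (k + 1) → R) (j : ℕ) : R := v ⟨min j k, by omega⟩

lemma extend_val {R : Type*} {k : ℕ} (v : Fin (k + 1) → R) (j : Fin (k + 1)) :
    extend v j = v j := by
  rw [extend]; congr 1; ext; simp; omega

lemma natWord_extend {k : ℕ} (v : Fin (k + 1) → A) : natWord K k (extend v) = word K A k v := by
  rw [natWord]; congr 1; funext j; exact extend_val v j

variable {𝒜 : ℤ → Submodule K A}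

lemma natWord_mem_unGr {k : ℕ} {w : ℕ → A} {e : ℕ → ℤ} {n : ℤ} (hw : ∀ j, w j ∈ 𝒜 (e j))
    (hn : ∑ j ∈ Finset.range (k + 1), e j + k = n) : natWord K k w ∈ unGr 𝒜 n :=
  Submodule.subset_span ⟨k, _, fun j => e j, fun j => hw j, by
    rw [Fin.sum_univ_eq_sum_range (fun j => e j) (k + 1)]; exact hn, rfl⟩

lemma unGr_le {n : ℤ} {N : Submodule K (Un K A)}
    (h : ∀ (k : ℕ) (w : ℕ → A) (e : ℕ → ℤ), (∀ j, w j ∈ 𝒜 (e j)) →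
      ∑ j ∈ Finset.range (k + 1), e j + k = n → natWord K k w ∈ N) : unGr 𝒜 n ≤ N := by
  refine Submodule.span_le.2 ?_
  rintro _ ⟨k, w, e, hw, hn, rfl⟩
  have := h k (extend w) (extend e) (fun j => hw _) (by
    rw [← hn, ← Fin.sum_univ_eq_sum_range (fun j => extend e j) (k + 1)]
    simp only [extend_val])
  rwa [natWord_extend] at this

variable [GradedAlgebra 𝒜]

lemma bDiff_natWord (d : A →ₗ[K] A) (k : ℕ) (w : ℕ → A) (q : ℕ → ZMod 2)
    (hw : ∀ j, w j ∈ parity 𝒜 (q j)) :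
    bDiff 𝒜 d (natWord K k w) = -∑ i ∈ Finset.range (k + 1),
      sgn (natEps q i) • natWord K k (Function.update w i (d (w i))) := by
  rw [bDiff, natWord, liftUn_word, neg_apply, sum_apply, Finset.sum_range]
  congr 1
  refine Finset.sum_congr rfl fun i _ => ?_
  rw [koszul_apply _ _ _ (fun j => q j) (fun j => hw j), eps_eq q (by omega)]
  congr 1
  rw [diffAt, MultilinearMap.compLinearMap_apply, natWord]
  congr 1; funext j
  simp only [Function.update_apply, Fin.ext_iff]
  split_ifs with h
  · rw [h]
  · rfl

lemma bMul_natWord_zero (w : ℕ → A) : bMul 𝒜 (natWord K 0 w) = 0 := by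
  rw [bMul, natWord, liftUn_word]
  rfl

lemma bMul_natWord (k : ℕ) (w : ℕ → A) (q : ℕ → ZMod 2)
    (hw : ∀ j, w j ∈ parity 𝒜 (q j)) :
    bMul 𝒜 (natWord K (k + 1) w) = -∑ i ∈ Finset.range (k + 1),
      sgn (natEps q (i + 1)) • natWord K k (merge (· * ·) i w) +
      sgn ((q (k + 1) + 1) * natEps q (k + 1)) • natWord K k (mergeLast (· * ·) (k + 1) w) := by
  rw [bMul, natWord, liftUn_word, add_apply, neg_apply, sum_apply, Finset.sum_range]
  congr 1
  · congr 1
    refine Finset.sum_congr rfl fun i _ => ?_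
    rw [koszul_apply _ _ _ (fun j => q j) (fun j => hw j), eps_eq' q (by omega)]
    congr 1
    change word K A k _ = word K A k _
    congr 1; funext j
    simp only [Fin.contractNth, merge, Fin.val_castSucc, Fin.val_succ]
    split_ifs with h1 h2
    · rfl
    · rw [h2]
    · rfl
  · rw [koszul_apply _ _ _ (fun j => q j) (fun j => hw j), eps_eq' q (by omega)]
    congr 1
    · rw [sub_eq_add_neg]; rfl
    · change word K A k _ = word K A k _
      congr 1; funext j
      simp only [Fin.contractNth, mergeLast, Equiv.coe_addLeft, Fin.castSucc_zero, Fin.val_zero]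
      have hl : ∀ x : Fin (k + 1), Fin.last (k + 1) + x.succ = x.castSucc := by
        intro x
        ext
        rw [Fin.val_add, Fin.val_last, Fin.val_succ, Fin.val_castSucc,
          show k + 1 + (↑x + 1) = x + (k + 1 + 1) by omega, Nat.add_mod_right,
          Nat.mod_eq_of_lt (by omega)]
      simp only [hl, Fin.val_castSucc, Nat.not_lt_zero, if_false]
      split_ifs with h
      · obtain rfl : j = 0 := Fin.ext h
        simp
      · rfl

lemma BUn_natWord (k : ℕ) (w : ℕ → A) (q : ℕ → ZMod 2) (hw : ∀ j, w j ∈ parity 𝒜 (q j)) :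
    BUn 𝒜 (natWord K k w) = ∑ i ∈ Finset.range (k + 1),
      sgn ((natEps q i + 1) * (natEps q (k + 1) + natEps q i)) •
        natWord K (k + 1) (rot 1 k i w) := by
  rw [BUn, natWord, liftUn_word, sum_apply, Finset.sum_range]
  refine Finset.sum_congr rfl fun i _ => ?_
  rw [koszul_apply _ _ _ (fun j => q j) (fun j => hw j), eps_eq q (by omega),
    eps_eq' q (by omega), sub_eq_add_neg (natEps q (k + 1)), ZMod.neg_eq_self_mod_two]
  congr 1
  change word K A (k + 1) _ = word K A (k + 1) _
  congr 1; funext j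
  refine Fin.cases ?_ (fun j => ?_) j
  · simp [rot]
  · simp only [Fin.cons_succ, rot, Fin.val_succ, Equiv.coe_addLeft, Nat.add_eq_zero_iff, one_ne_zero,
      and_false, if_false, Fin.val_add]
    split_ifs with h
    · rw [Nat.mod_eq_of_lt (by omega)]; rfl
    · rw [Nat.mod_eq_sub_mod (by omega), Nat.mod_eq_of_lt (by omega)]
      rfl

/-- Linear maps on unnormalised chains agree if they agree on homogeneous chains. -/
lemma un_ext {M : Type*} [AddCommGroup M] [Module K M] {f g : Un K A →ₗ[K] M}
    (h : ∀ (k : ℕ) (w : ℕ → A) (q : ℕ → ZMod 2), (∀ j, w j ∈ parity 𝒜 (q j)) →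
      f (natWord K k w) = g (natWord K k w)) : f = g := by
  refine linearMap_ext_word fun k w => ?_
  rw [multilinear_eq_sum (𝒜 := 𝒜) (word K A k), map_sum, map_sum]
  refine Finset.sum_congr rfl fun p _ => ?_
  have := h k (extend fun j => parityPart 𝒜 (p j) (w j)) (extend p) (fun j => parityPart_mem _ _)
  rw [natWord_extend] at this
  exact this

/-- A linear map that sends homogeneous degenerate chains into `N` sends all degenerate chains
into `N`. -/
lemma degen_le {M : Type*} [AddCommGroup M] [Module K M] {f : Un K A →ₗ[K] M}
    {N : Submodule K M}
    (h : ∀ (k : ℕ) (w : ℕ → A) (q : ℕ → ZMod 2), (∀ j, w j ∈ parity 𝒜 (q j)) →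
      ∀ j ≤ k, j ≠ 0 → w j = 1 → f (natWord K k w) ∈ N) : degen K A ≤ N.comap f := by
  refine Submodule.span_le.2 ?_
  rintro _ ⟨k, w, j, hj, hw, rfl⟩
  change f (word K A k w) ∈ N
  rw [multilinear_eq_sum (𝒜 := 𝒜) (word K A k), map_sum]
  refine Submodule.sum_mem _ fun p _ => ?_
  by_cases hp : p j = 0
  · have := h k (extend fun j => parityPart 𝒜 (p j) (w j)) (extend p)
      (fun j => parityPart_mem _ _) j (by omega) (fun h0 => hj (Fin.ext h0))
      (by rw [extend_val, hw, hp, parityPart_of_mem one_mem_parity, if_pos rfl])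
    rwa [natWord_extend] at this
  · rw [(word K A k).map_coord_zero j, map_zero]
    · exact N.zero_mem
    · rw [hw, parityPart_of_mem one_mem_parity, if_neg hp]

end Formulas

/-! ### The identities of a mixed complex -/

section Identities

lemma natEps_zero (q : ℕ → ZMod 2) : natEps q 0 = 1 := by simp [natEps]

lemma natEps_succ (q : ℕ → ZMod 2) (j : ℕ) : natEps q (j + 1) = natEps q j + q j + 1 := by
  simp only [natEps, Finset.sum_range_succ]; push_cast; ring

lemma natEps_congr {q q' : ℕ → ZMod 2} {j : ℕ} (h : ∀ t < j, q t = q' t) :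
    natEps q j = natEps q' j := by
  rw [natEps, natEps, Finset.sum_congr rfl fun t ht => h t (Finset.mem_range.1 ht)]

lemma natEps_update (q : ℕ → ZMod 2) (i j : ℕ) :
    natEps (Function.update q i (q i + 1)) j = natEps q j + if i < j then 1 else 0 := by
  induction j with
  | zero => simp [natEps_zero]
  | succ j ih =>
    rw [natEps_succ, natEps_succ, ih, Function.update_apply]
    split_ifs <;> first | omega | (subst_vars; ring)

lemma natEps_merge (q : ℕ → ZMod 2) (i j : ℕ) :
    natEps (merge (· + ·) i q) j = if j ≤ i then natEps q j else natEps q (j + 1) + 1 := by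
  induction j with
  | zero => simp [natEps_zero]
  | succ j ih =>
    rw [natEps_succ, ih, natEps_succ, merge, natEps_succ, natEps_succ]
    rcases lt_trichotomy j i with h | h | h
    · rw [if_pos (by omega), if_pos h, if_pos (by omega)]
    · subst h
      rw [if_pos le_rfl, if_neg (lt_irrefl _), if_pos rfl, if_neg (by omega)]
      generalize natEps q j = a
      generalize q j = b
      generalize q (j + 1) = c
      revert a b c; decide
    · rw [if_neg (by omega), if_neg (by omega), if_neg (by omega), if_neg (by omega)]
      ring

lemma natEps_mergeLast (q : ℕ → ZMod 2) (k j : ℕ) :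
    natEps (mergeLast (· + ·) k q) j = natEps q j + if j = 0 then 0 else q k := by
  induction j with
  | zero => simp [natEps_zero]
  | succ j ih =>
    rw [natEps_succ, natEps_succ, ih, mergeLast]
    rcases Nat.eq_zero_or_pos j with h | h
    · subst h; simp only [if_true, Nat.add_eq_zero_iff, one_ne_zero, and_false, if_false]; ring
    · rw [if_neg h.ne', if_neg (Nat.succ_ne_zero j), if_neg h.ne']; ring

lemma natEps_rot (q : ℕ → ZMod 2) {k i : ℕ} (hi : i ≤ k) (j : ℕ) :
    natEps (rot 0 k i q) (j + 1) = if i + j ≤ k + 1 then natEps q (i + j) + natEps q i else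
      natEps q (k + 1) + natEps q i + natEps q (i + j - (k + 1)) + 1 := by
  induction j with
  | zero =>
    rw [natEps_succ, natEps_zero, if_pos (by omega), rot, if_pos rfl, add_zero]
    generalize natEps q i = a
    revert a; decide
  | succ j ih =>
    have hr : rot 0 k i q (j + 1) =
        if i + (j + 1) ≤ k + 1 then q (i + j) else q (i + j - (k + 1)) := by
      rw [rot, if_neg (Nat.succ_ne_zero j)]; rfl
    rw [natEps_succ, ih, hr]
    rcases lt_trichotomy (i + j) (k + 1) with h | h | h
    · rw [if_pos h.le, if_pos (by omega : i + (j + 1) ≤ k + 1), if_pos (by omega), ← add_assoc i j 1,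
        natEps_succ]
      ring
    · rw [if_pos h.le, if_neg (by omega : ¬ i + (j + 1) ≤ k + 1), if_neg (by omega), h,
        show i + (j + 1) - (k + 1) = 0 + 1 by omega, natEps_succ q 0, natEps_zero, Nat.sub_self]
      generalize natEps q i = a
      generalize natEps q (k + 1) = b
      generalize q 0 = c
      revert a b c; decide
    · rw [if_neg (by omega), if_neg (by omega : ¬ i + (j + 1) ≤ k + 1), if_neg (by omega),
        show i + (j + 1) - (k + 1) = (i + j - (k + 1)) + 1 by omega,
        natEps_succ q (i + j - (k + 1))]
      ring

variable {M : Type*} [AddCommGroup M]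

lemma sgn_cancel {x y : ZMod 2} {a b : M} (h : x + y = 1) (hab : a = b) :
    sgn x • a + sgn y • b = 0 := by
  subst hab
  rw [← add_smul]
  have : sgn x + sgn y = 0 := by revert x y; decide
  rw [this, zero_smul]

lemma sum_antisymm (n : ℕ) (F : ℕ → ℕ → M) (h0 : ∀ i < n, F i i = 0)
    (h : ∀ i j, i < j → j < n → F i j + F j i = 0) :
    ∑ i ∈ Finset.range n, ∑ j ∈ Finset.range n, F i j = 0 := by
  induction n with
  | zero => simp
  | succ n ih =>
    simp only [Finset.sum_range_succ, Finset.sum_add_distrib]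
    rw [ih (fun i hi => h0 i (by omega)) (fun i j hij hj => h i j hij (by omega)),
      h0 n (by omega), add_zero, zero_add, ← Finset.sum_add_distrib]
    exact Finset.sum_eq_zero fun i hi => by
      rw [add_comm]; exact h i n (Finset.mem_range.1 hi) (by omega)

lemma sum_simplicial (n : ℕ) (F : ℕ → ℕ → M)
    (h : ∀ i j, i ≤ j → j < n → F i j + F (j + 1) i = 0) :
    ∑ i ∈ Finset.range (n + 1), ∑ j ∈ Finset.range n, F i j = 0 := by
  induction n with
  | zero => simp
  | succ n ih =>
    have h1 : ∑ i ∈ Finset.range (n + 1 + 1), ∑ j ∈ Finset.range (n + 1), F i j =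
        (∑ i ∈ Finset.range (n + 1), ∑ j ∈ Finset.range n, F i j) +
          ∑ i ∈ Finset.range (n + 1), (F i n + F (n + 1) i) := by
      rw [Finset.sum_range_succ, Finset.sum_add_distrib, ← add_assoc, ← Finset.sum_add_distrib]
      simp only [Finset.sum_range_succ _ n, Finset.sum_add_distrib]
      abel
    rw [h1, ih (fun i j hij hj => h i j hij (by omega)), zero_add]
    exact Finset.sum_eq_zero fun i hi =>
      h i n (Nat.lt_succ_iff.1 (Finset.mem_range.1 hi)) (Nat.lt_succ_self n)

lemma sum_split (n i : ℕ) (hi : i ≤ n) (f : ℕ → M) :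
    ∑ j ∈ Finset.range n, f j =
      ∑ j ∈ Finset.range i, f j + ∑ j ∈ Finset.range (n - i), f (i + j) := by
  rw [← Finset.sum_range_add, Nat.add_sub_cancel' hi]

end Identities

section MixedIdentities

variable {K : Type*} [Field K] {A : Type*} [Ring A] [Algebra K A]
variable {𝒜 : ℤ → Submodule K A} [GradedAlgebra 𝒜]

lemma par_update (Ω : NonposCDGA 𝒜) {w : ℕ → A} {q : ℕ → ZMod 2}
    (hw : ∀ j, w j ∈ parity 𝒜 (q j)) (i j : ℕ) :
    Function.update w i (Ω.d (w i)) j ∈ parity 𝒜 (Function.update q i (q i + 1) j) := by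
  simp only [Function.update_apply]
  split_ifs
  · exact d_mem_parity Ω (hw i)
  · exact hw j

lemma par_merge {w : ℕ → A} {q : ℕ → ZMod 2} (hw : ∀ j, w j ∈ parity 𝒜 (q j)) (i j : ℕ) :
    merge (· * ·) i w j ∈ parity 𝒜 (merge (· + ·) i q j) := by
  simp only [merge]
  split_ifs
  · exact hw j
  · exact mul_mem_parity (hw i) (hw (i + 1))
  · exact hw (j + 1)

lemma par_mergeLast {w : ℕ → A} {q : ℕ → ZMod 2} (hw : ∀ j, w j ∈ parity 𝒜 (q j)) (k j : ℕ) :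
    mergeLast (· * ·) k w j ∈ parity 𝒜 (mergeLast (· + ·) k q j) := by
  simp only [mergeLast]
  split_ifs
  · exact mul_mem_parity (hw k) (hw 0)
  · exact hw j

lemma par_rot {w : ℕ → A} {q : ℕ → ZMod 2} (hw : ∀ j, w j ∈ parity 𝒜 (q j)) (k i j : ℕ) :
    rot 1 k i w j ∈ parity 𝒜 (rot 0 k i q j) := by
  simp only [rot]
  split_ifs
  · exact one_mem_parity
  · exact hw _
  · exact hw _

lemma bDiff_bDiff (Ω : NonposCDGA 𝒜) : bDiff 𝒜 Ω.d ∘ₗ bDiff 𝒜 Ω.d = 0 := by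
  refine un_ext (𝒜 := 𝒜) fun k w q hw => ?_
  rw [LinearMap.comp_apply, LinearMap.zero_apply, bDiff_natWord _ k w q hw, map_neg, map_sum, neg_eq_zero]
  simp only [map_zsmul, fun i => bDiff_natWord Ω.d k _ _ (par_update Ω hw i), smul_neg,
    Finset.sum_neg_distrib, Finset.smul_sum, smul_smul, ← sgn_add]
  rw [neg_eq_zero]
  refine sum_antisymm _ _ (fun i hi => ?_) (fun i j hij hj => ?_)
  · rw [natWord_eq_zero (j := i) (by omega) (by simp [Ω.d_d]), smul_zero]
  · refine sgn_cancel ?_ ?_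
    · rw [natEps_update, natEps_update, if_pos hij, if_neg (by omega)]
      generalize natEps q i = a
      generalize natEps q j = b
      revert a b; decide
    · rw [Function.update_of_ne (by omega), Function.update_of_ne (by omega),
        Function.update_comm (by omega)]

/-- The sign exponent of the `i`-th term of `bMul` on chains `(w₀, …, w_{k+1})`. -/
def faceSign (q : ℕ → ZMod 2) (k i : ℕ) : ZMod 2 :=
  if i ≤ k then natEps q (i + 1) else (q (k + 1) + 1) * natEps q (k + 1) + 1

/-- The `i`-th term of `bMul` on sequences of letters. -/
def face {R : Type*} (op : R → R → R) (k i : ℕ) (w : ℕ → R) : ℕ → R :=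
  if i ≤ k then merge op i w else mergeLast op (k + 1) w

lemma face_merge {R : Type*} (op : R → R → R) {k i : ℕ} (h : i ≤ k) (w : ℕ → R) :
    face op k i w = merge op i w := if_pos h

lemma face_last {R : Type*} (op : R → R → R) (k : ℕ) (w : ℕ → R) :
    face op k (k + 1) w = mergeLast op (k + 1) w := if_neg (by omega)

lemma par_face {w : ℕ → A} {q : ℕ → ZMod 2} (hw : ∀ j, w j ∈ parity 𝒜 (q j)) (k i j : ℕ) :
    face (· * ·) k i w j ∈ parity 𝒜 (face (· + ·) k i q j) := by
  simp only [face]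
  split_ifs
  · exact par_merge hw i j
  · exact par_mergeLast hw _ j

lemma bMul_natWord_face (k : ℕ) (w : ℕ → A) (q : ℕ → ZMod 2)
    (hw : ∀ j, w j ∈ parity 𝒜 (q j)) :
    bMul 𝒜 (natWord K (k + 1) w) = -∑ i ∈ Finset.range (k + 2),
      sgn (faceSign q k i) • natWord K k (face (· * ·) k i w) := by
  rw [bMul_natWord k w q hw, Finset.sum_range_succ _ (k + 1), neg_add]
  congr 1
  · congr 1
    refine Finset.sum_congr rfl fun i hi => ?_
    have : i ≤ k := by have := Finset.mem_range.1 hi; omega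
    simp only [faceSign, face, if_pos this]
  · have : ¬ k + 1 ≤ k := by omega
    simp only [faceSign, face, if_neg this, sgn_add]
    rw [show sgn 1 = -1 from rfl, mul_neg_one, neg_smul, neg_neg]

lemma natEps_face_merge (q : ℕ → ZMod 2) {k i : ℕ} (h : i ≤ k) (j : ℕ) :
    natEps (face (· + ·) k i q) j = if j ≤ i then natEps q j else natEps q (j + 1) + 1 := by
  rw [face, if_pos h, natEps_merge]

lemma natEps_face_last (q : ℕ → ZMod 2) (k j : ℕ) :
    natEps (face (· + ·) k (k + 1) q) (j + 1) = natEps q (j + 1) + q (k + 1) := by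
  rw [face, if_neg (by omega), natEps_mergeLast, if_neg (by omega)]

lemma bMul_bMul : bMul 𝒜 ∘ₗ bMul 𝒜 = 0 := by
  refine un_ext (𝒜 := 𝒜) fun k w q hw => ?_
  rw [LinearMap.comp_apply, LinearMap.zero_apply]
  obtain _ | _ | k := k
  · rw [bMul_natWord_zero, map_zero]
  · rw [bMul_natWord_face 0 w q hw, map_neg, map_sum, neg_eq_zero]
    simp only [map_zsmul, bMul_natWord_zero, smul_zero, Finset.sum_const_zero]
  rw [bMul_natWord_face (k + 1) w q hw, map_neg, map_sum, neg_eq_zero]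
  simp only [map_zsmul, fun i => bMul_natWord_face k _ _ (par_face hw (k + 1) i), smul_neg,
    Finset.sum_neg_distrib, Finset.smul_sum, smul_smul, ← sgn_add]
  rw [neg_eq_zero]
  refine sum_simplicial _ _ (fun i j hij hj => sgn_cancel ?_ (natWord_congr fun t ht => ?_))
  · rcases Nat.lt_or_ge k j with hjk | hjk
    · obtain rfl : j = k + 1 := by omega
      rcases Nat.lt_or_ge k i with hik | hik
      · obtain rfl : i = k + 1 := by omega
        simp only [faceSign, natEps_face_merge q (le_refl (k + 1)), natEps_face_last]
        simp only [face, merge, mergeLast, le_refl, if_true, if_neg (Nat.not_succ_le_self _),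
          if_neg (lt_irrefl _), natEps_succ q (k + 1), if_neg (Nat.succ_ne_zero k)]
        generalize natEps q (k + 1) = a
        generalize q (k + 1) = b
        generalize q (k + 1 + 1) = c
        revert a b c; decide
      · simp only [faceSign, natEps_face_merge q (by omega : i ≤ k + 1), natEps_face_last]
        simp only [face, merge, mergeLast, if_neg (Nat.not_succ_le_self _),
          if_pos hik, if_pos (by omega : i ≤ k + 1), if_neg (by omega : ¬ k + 1 ≤ i),
          if_neg (by omega : ¬ k + 1 < i), if_neg (by omega : ¬ k + 1 = i)]
        generalize natEps q (i + 1) = a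
        generalize natEps q (k + 1 + 1) = b
        generalize q (k + 1 + 1) = c
        revert a b c; decide
    · simp only [faceSign, natEps_face_merge q (by omega : i ≤ k + 1),
        natEps_face_merge q (by omega : j + 1 ≤ k + 1), if_pos hjk, if_pos (by omega : i ≤ k),
        if_pos (by omega : i ≤ k + 1), if_pos (by omega : j + 1 ≤ k + 1),
        if_pos (by omega : i + 1 ≤ j + 1), if_neg (by omega : ¬ j + 1 ≤ i)]
      generalize natEps q (i + 1) = a
      generalize natEps q (j + 1 + 1) = b
      revert a b; decide
  · rcases Nat.lt_or_ge k j with hjk | hjk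
    · obtain rfl : j = k + 1 := by omega
      rcases Nat.lt_or_ge k i with hik | hik
      · obtain rfl : i = k + 1 := by omega
        simp only [face_last _ k, face_last _ (k + 1), face_merge _ (le_refl (k + 1)), merge,
          mergeLast]
        grind [mul_assoc]
      · rw [face_last _ k, face_last _ (k + 1), face_merge _ hik, face_merge _ (by omega)]
        simp only [merge, mergeLast]
        grind [mul_assoc]
    · simp only [face, merge, if_pos hjk, if_pos (by omega : i ≤ k), if_pos (by omega : i ≤ k + 1),
        if_pos (by omega : j + 1 ≤ k + 1)]
      grind [mul_assoc]

lemma add_aux {M : Type*} [AddCommGroup M] {a b c d e f g : M} (h1 : a + c = 0) (h2 : b + d = 0)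
    (h3 : e + (f + g) = 0) : a + (b + e) + (c + (d + f + g)) = 0 := by
  calc a + (b + e) + (c + (d + f + g)) = (a + c) + (b + d) + (e + (f + g)) := by abel
    _ = 0 := by rw [h1, h2, h3, add_zero, add_zero]

lemma add_aux' {M : Type*} [AddCommGroup M] {a c e f g : M} (h1 : a + c = 0)
    (h3 : e + (f + g) = 0) : a + e + (c + f + g) = 0 := by
  calc a + e + (c + f + g) = (a + c) + (e + (f + g)) := by abel
    _ = 0 := by rw [h1, h3, add_zero]

/-- The terms `d` and merging of letters `0 ≤ i < i + 1 ≤ k + 1` anticommute. -/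
lemma face_diff_merge (Ω : NonposCDGA 𝒜) {w : ℕ → A} {q : ℕ → ZMod 2}
    (hw : ∀ j, w j ∈ parity 𝒜 (q j)) {k i : ℕ} (hi : i ≤ k) :
    ∑ j ∈ Finset.range (k + 1), sgn (faceSign q k i + natEps (face (· + ·) k i q) j) •
        natWord K k (Function.update (face (· * ·) k i w) j (Ω.d (face (· * ·) k i w j))) +
      ∑ j ∈ Finset.range (k + 2),
        sgn (natEps q j + faceSign (Function.update q j (q j + 1)) k i) •
          natWord K k (face (· * ·) k i (Function.update w j (Ω.d (w j)))) = 0 := by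
  have hs1 : faceSign q k i = natEps q (i + 1) := if_pos hi
  have hs2 : ∀ j, faceSign (Function.update q j (q j + 1)) k i =
      natEps q (i + 1) + if j < i + 1 then 1 else 0 := fun j => by
    rw [faceSign, if_pos hi, natEps_update]
  simp only [hs1, hs2, face_merge _ hi, natEps_merge]
  rw [sum_split (k + 1) i (by omega), sum_split (k + 2) i (by omega),
    show k + 1 - i = (k - i) + 1 by omega, show k + 2 - i = (k - i) + 1 + 1 by omega,
    Finset.sum_range_succ', Finset.sum_range_succ', Finset.sum_range_succ']
  have h1 : ∀ j ∈ Finset.range i, sgn (natEps q (i + 1) +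
        if j ≤ i then natEps q j else natEps q (j + 1) + 1) •
        natWord K k (Function.update (merge (· * ·) i w) j (Ω.d (merge (· * ·) i w j))) +
      sgn (natEps q j + (natEps q (i + 1) + if j < i + 1 then 1 else 0)) •
          natWord K k (merge (· * ·) i (Function.update w j (Ω.d (w j)))) = 0 := by
    intro j hj
    have hj := Finset.mem_range.1 hj
    rw [if_pos hj.le, if_pos (by omega)]
    refine sgn_cancel ?_ (natWord_congr fun t _ => ?_)
    · generalize natEps q j = a
      generalize natEps q (i + 1) = b
      revert a b; decide
    · simp only [Function.update_apply, merge]; grind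
  have h2 : ∀ j ∈ Finset.range (k - i), sgn (natEps q (i + 1) +
        if i + (j + 1) ≤ i then natEps q (i + (j + 1)) else natEps q (i + (j + 1) + 1) + 1) •
        natWord K k (Function.update (merge (· * ·) i w) (i + (j + 1))
          (Ω.d (merge (· * ·) i w (i + (j + 1))))) +
      sgn (natEps q (i + (j + 1 + 1)) +
          (natEps q (i + 1) + if i + (j + 1 + 1) < i + 1 then 1 else 0)) •
          natWord K k (merge (· * ·) i (Function.update w (i + (j + 1 + 1))
            (Ω.d (w (i + (j + 1 + 1)))))) = 0 := by
    intro j hj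
    have hj := Finset.mem_range.1 hj
    rw [if_neg (by omega), if_neg (by omega), ← add_assoc i (j + 1) 1]
    refine sgn_cancel ?_ (natWord_congr fun t _ => ?_)
    · generalize natEps q (i + (j + 1) + 1) = a
      generalize natEps q (i + 1) = b
      revert a b; decide
    · simp only [Function.update_apply, merge]; grind
  have h3 : sgn (natEps q (i + 1) +
        if i + 0 ≤ i then natEps q (i + 0) else natEps q (i + 0 + 1) + 1) •
        natWord K k (Function.update (merge (· * ·) i w) (i + 0)
          (Ω.d (merge (· * ·) i w (i + 0)))) +
      (sgn (natEps q (i + (0 + 1)) +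
          (natEps q (i + 1) + if i + (0 + 1) < i + 1 then 1 else 0)) •
          natWord K k (merge (· * ·) i (Function.update w (i + (0 + 1))
            (Ω.d (w (i + (0 + 1)))))) +
       sgn (natEps q (i + 0) +
          (natEps q (i + 1) + if i + 0 < i + 1 then 1 else 0)) •
          natWord K k (merge (· * ·) i (Function.update w (i + 0)
            (Ω.d (w (i + 0)))))) = 0 := by
    simp only [add_zero, zero_add, le_refl, if_true, lt_irrefl, if_false, Nat.lt_succ_self]
    have e1 : natWord K k (Function.update (merge (· * ·) i w) i (Ω.d (merge (· * ·) i w i))) =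
        natWord K k (merge (· * ·) i (Function.update w i (Ω.d (w i)))) +
          sgn (q i) • natWord K k (merge (· * ·) i (Function.update w (i + 1) (Ω.d (w (i + 1))))) := by
      have e2 := natWord_zsmul (K := K)
        (w := Function.update (merge (· * ·) i w) i (sgn (q i) • (w i * Ω.d (w (i + 1)))))
        (w' := merge (· * ·) i (Function.update w (i + 1) (Ω.d (w (i + 1))))) hi (sgn (q i))
        (by simp [merge])
        (fun t _ hti => by simp only [Function.update_apply, merge]; grind)
      rw [← e2]
      refine natWord_add hi ?_ (fun t _ hti => ?_) (fun t _ hti => ?_)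
      · simp [merge, leibniz_parity Ω _ (hw i)]
      · simp only [Function.update_apply, merge]; grind
      · simp only [Function.update_apply]; grind
    rw [e1, smul_add, smul_smul, ← sgn_add, natEps_succ]
    rw [add_comm (sgn _ • natWord K k (merge _ i (Function.update w (i + 1) _))),
      add_add_add_comm, sgn_cancel ?_ rfl, sgn_cancel ?_ rfl, add_zero]
    · generalize natEps q i = a
      generalize q i = b
      revert a b; decide
    · generalize natEps q i = a
      generalize q i = b
      revert a b; decide
  have H1 := Finset.sum_eq_zero h1
  have H2 := Finset.sum_eq_zero h2
  rw [Finset.sum_add_distrib] at H1 H2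
  exact add_aux H1 H2 h3

lemma face_diff_last (Ω : NonposCDGA 𝒜) {w : ℕ → A} {q : ℕ → ZMod 2}
    (hw : ∀ j, w j ∈ parity 𝒜 (q j)) (k : ℕ) :
    ∑ j ∈ Finset.range (k + 1),
        sgn (faceSign q k (k + 1) + natEps (face (· + ·) k (k + 1) q) j) •
        natWord K k (Function.update (face (· * ·) k (k + 1) w) j
          (Ω.d (face (· * ·) k (k + 1) w j))) +
      ∑ j ∈ Finset.range (k + 2),
        sgn (natEps q j + faceSign (Function.update q j (q j + 1)) k (k + 1)) •
          natWord K k (face (· * ·) k (k + 1) (Function.update w j (Ω.d (w j)))) = 0 := by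
  have hs : ∀ q : ℕ → ZMod 2, faceSign q k (k + 1) =
      (q (k + 1) + 1) * natEps q (k + 1) + 1 := fun q => if_neg (by omega)
  simp only [hs, face_last, natEps_mergeLast, natEps_update, Function.update_apply q]
  rw [Finset.sum_range_succ', Finset.sum_range_succ _ (k + 1), Finset.sum_range_succ']
  have h1 : ∀ j ∈ Finset.range k,
      sgn ((q (k + 1) + 1) * natEps q (k + 1) + 1 +
          (natEps q (j + 1) + if j + 1 = 0 then 0 else q (k + 1))) •
        natWord K k (Function.update (mergeLast (· * ·) (k + 1) w) (j + 1)
          (Ω.d (mergeLast (· * ·) (k + 1) w (j + 1)))) +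
      sgn (natEps q (j + 1) + (((if k + 1 = j + 1 then q (j + 1) + 1 else q (k + 1)) + 1) *
          (natEps q (k + 1) + if j + 1 < k + 1 then 1 else 0) + 1)) •
        natWord K k (mergeLast (· * ·) (k + 1)
          (Function.update w (j + 1) (Ω.d (w (j + 1))))) = 0 := by
    intro j hj
    have hj := Finset.mem_range.1 hj
    rw [if_neg (Nat.succ_ne_zero j), if_neg (by omega), if_pos (by omega)]
    refine sgn_cancel ?_ (natWord_congr fun t ht => ?_)
    · generalize natEps q (j + 1) = a
      generalize natEps q (k + 1) = b
      generalize q (k + 1) = c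
      revert a b c; decide
    · simp only [Function.update_apply, mergeLast]; grind
  have e1 : natWord K k (Function.update (mergeLast (· * ·) (k + 1) w) 0
        (Ω.d (mergeLast (· * ·) (k + 1) w 0))) =
      natWord K k (mergeLast (· * ·) (k + 1) (Function.update w (k + 1) (Ω.d (w (k + 1))))) +
        sgn (q (k + 1)) •
          natWord K k (mergeLast (· * ·) (k + 1) (Function.update w 0 (Ω.d (w 0)))) := by
    have e2 := natWord_zsmul (K := K)
      (w := Function.update (mergeLast (· * ·) (k + 1) w) 0
        (sgn (q (k + 1)) • (w (k + 1) * Ω.d (w 0))))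
      (w' := mergeLast (· * ·) (k + 1) (Function.update w 0 (Ω.d (w 0)))) (Nat.zero_le k)
      (sgn (q (k + 1))) (by simp [mergeLast])
      (fun t ht hti => by simp only [Function.update_apply, mergeLast]; grind)
    rw [← e2]
    refine natWord_add (Nat.zero_le k) ?_ (fun t ht hti => ?_) (fun t ht hti => ?_)
    · simp [mergeLast, leibniz_parity Ω _ (hw (k + 1))]
    · simp only [Function.update_apply, mergeLast]; grind
    · simp only [Function.update_apply]; grind
  have h3 : sgn ((q (k + 1) + 1) * natEps q (k + 1) + 1 +
          (natEps q 0 + if 0 = 0 then 0 else q (k + 1))) •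
        natWord K k (Function.update (mergeLast (· * ·) (k + 1) w) 0
          (Ω.d (mergeLast (· * ·) (k + 1) w 0))) +
      (sgn (natEps q 0 + (((if k + 1 = 0 then q 0 + 1 else q (k + 1)) + 1) *
          (natEps q (k + 1) + if 0 < k + 1 then 1 else 0) + 1)) •
        natWord K k (mergeLast (· * ·) (k + 1) (Function.update w 0 (Ω.d (w 0)))) +
       sgn (natEps q (k + 1) + (((if k + 1 = k + 1 then q (k + 1) + 1 else q (k + 1)) + 1) *
          (natEps q (k + 1) + if k + 1 < k + 1 then 1 else 0) + 1)) •
        natWord K k (mergeLast (· * ·) (k + 1)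
          (Function.update w (k + 1) (Ω.d (w (k + 1)))))) = 0 := by
    rw [e1, smul_add, smul_smul, ← sgn_add, if_pos rfl, if_pos rfl, if_neg (Nat.succ_ne_zero k),
      if_pos (Nat.succ_pos k), if_neg (lt_irrefl _), natEps_zero,
      add_comm (sgn _ • natWord K k (mergeLast _ (k + 1) (Function.update w 0 _))),
      add_add_add_comm, sgn_cancel ?_ rfl, sgn_cancel ?_ rfl, add_zero]
    · generalize natEps q (k + 1) = a
      generalize q (k + 1) = b
      revert a b; decide
    · generalize natEps q (k + 1) = a
      generalize q (k + 1) = b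
      revert a b; decide
  have H1 := Finset.sum_eq_zero h1
  rw [Finset.sum_add_distrib] at H1
  exact add_aux' H1 h3

lemma face_diff (Ω : NonposCDGA 𝒜) {w : ℕ → A} {q : ℕ → ZMod 2}
    (hw : ∀ j, w j ∈ parity 𝒜 (q j)) {k i : ℕ} (hi : i < k + 2) :
    ∑ j ∈ Finset.range (k + 1), sgn (faceSign q k i + natEps (face (· + ·) k i q) j) •
        natWord K k (Function.update (face (· * ·) k i w) j (Ω.d (face (· * ·) k i w j))) +
      ∑ j ∈ Finset.range (k + 2),
        sgn (natEps q j + faceSign (Function.update q j (q j + 1)) k i) •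
          natWord K k (face (· * ·) k i (Function.update w j (Ω.d (w j)))) = 0 := by
  rcases Nat.lt_or_ge k i with h | h
  · obtain rfl : i = k + 1 := by omega
    exact face_diff_last Ω hw k
  · exact face_diff_merge Ω hw h

lemma bDiff_bMul (Ω : NonposCDGA 𝒜) : bDiff 𝒜 Ω.d ∘ₗ bMul 𝒜 + bMul 𝒜 ∘ₗ bDiff 𝒜 Ω.d = 0 := by
  refine un_ext (𝒜 := 𝒜) fun k w q hw => ?_
  rw [LinearMap.add_apply, LinearMap.comp_apply, LinearMap.comp_apply, LinearMap.zero_apply]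
  obtain _ | k := k
  · rw [bMul_natWord_zero, bDiff_natWord _ 0 w q hw, map_zero, map_neg, map_sum]
    simp only [map_zsmul, bMul_natWord_zero, smul_zero, Finset.sum_const_zero, neg_zero, add_zero]
  rw [bMul_natWord_face k w q hw, bDiff_natWord _ (k + 1) w q hw, map_neg, map_neg, map_sum,
    map_sum]
  simp only [map_zsmul, fun i => bMul_natWord_face k _ _ (par_update Ω hw i),
    fun i => bDiff_natWord Ω.d k _ _ (par_face hw k i), smul_neg,
    Finset.sum_neg_distrib, neg_neg, Finset.smul_sum, smul_smul, ← sgn_add]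
  rw [Finset.sum_comm (s := Finset.range (k + 1 + 1)) (t := Finset.range (k + 2)), ← Finset.sum_add_distrib]
  exact Finset.sum_eq_zero fun i hi => face_diff Ω hw (Finset.mem_range.1 hi)

lemma bUn_bUn (Ω : NonposCDGA 𝒜) : bUn 𝒜 Ω.d ∘ₗ bUn 𝒜 Ω.d = 0 := by
  rw [bUn, LinearMap.add_comp, LinearMap.comp_add, LinearMap.comp_add, bDiff_bDiff, bMul_bMul,
    zero_add, add_zero, bDiff_bMul]

/-- The exponent of the sign of the `i`-th term of `BUn`. -/
def rotSign (q : ℕ → ZMod 2) (k i : ℕ) : ZMod 2 :=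
  (natEps q i + 1) * (natEps q (k + 1) + natEps q i)

lemma BUn_natWord' (k : ℕ) (w : ℕ → A) (q : ℕ → ZMod 2) (hw : ∀ j, w j ∈ parity 𝒜 (q j)) :
    BUn 𝒜 (natWord K k w) = ∑ i ∈ Finset.range (k + 1),
      sgn (rotSign q k i) • natWord K (k + 1) (rot 1 k i w) := BUn_natWord k w q hw

lemma bDiff_BUn (Ω : NonposCDGA 𝒜) : bDiff 𝒜 Ω.d ∘ₗ BUn 𝒜 + BUn 𝒜 ∘ₗ bDiff 𝒜 Ω.d = 0 := by
  refine un_ext (𝒜 := 𝒜) fun k w q hw => ?_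
  rw [LinearMap.add_apply, LinearMap.comp_apply, LinearMap.comp_apply, LinearMap.zero_apply]
  rw [BUn_natWord' k w q hw, bDiff_natWord _ k w q hw, map_neg, map_sum, map_sum]
  simp only [map_zsmul, fun i => BUn_natWord' k _ _ (par_update Ω hw i),
    fun i => bDiff_natWord Ω.d (k + 1) _ _ (par_rot hw k i), smul_neg,
    Finset.sum_neg_distrib, Finset.smul_sum, smul_smul, ← sgn_add]
  rw [Finset.sum_comm (s := Finset.range (k + 1)) (t := Finset.range (k + 1)), ← neg_add,
    ← Finset.sum_add_distrib, neg_eq_zero]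
  refine Finset.sum_eq_zero fun i hi => ?_
  have hi : i ≤ k := Nat.lt_succ_iff.1 (Finset.mem_range.1 hi)
  rw [Finset.sum_range_succ', natWord_eq_zero (Nat.zero_le _) (by simp [rot, d_one]), smul_zero,
    add_zero, sum_split (k + 1) (k + 1 - i) (by omega), sum_split (k + 1) i (by omega) (fun _ => _),
    add_comm (∑ j ∈ Finset.range i, _), add_add_add_comm, Nat.sub_sub_self (by omega),
    ← Finset.sum_add_distrib, ← Finset.sum_add_distrib]
  rw [Finset.sum_eq_zero, Finset.sum_eq_zero, add_zero]
  · intro j hj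
    have hj := Finset.mem_range.1 hj
    refine sgn_cancel ?_ (natWord_congr fun t _ => ?_)
    · rw [natEps_rot q hi, rotSign, rotSign, natEps_update, natEps_update,
        show i + (k + 1 - i + j) = k + 1 + j by omega, Nat.add_sub_cancel_left,
        if_pos hj, if_pos (by omega : j < k + 1)]
      rcases Nat.eq_zero_or_pos j with h | h
      · subst h
        rw [if_pos le_rfl, natEps_zero, add_zero]
        generalize natEps q i = a
        generalize natEps q (k + 1) = b
        revert a b; decide
      · rw [if_neg (by omega : ¬ k + 1 + j ≤ k + 1)]
        generalize natEps q i = a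
        generalize natEps q (k + 1) = b
        generalize natEps q j = c
        revert a b c; decide
    · simp only [Function.update_apply, rot]; grind
  · intro j hj
    have hj := Finset.mem_range.1 hj
    refine sgn_cancel ?_ (natWord_congr fun t _ => ?_)
    · rw [natEps_rot q hi, rotSign, rotSign, natEps_update, natEps_update,
        if_pos (by omega : i + j ≤ k + 1), if_pos (by omega : i + j < k + 1),
        if_neg (by omega : ¬ i + j < i)]
      generalize natEps q i = a
      generalize natEps q (k + 1) = b
      generalize natEps q (i + j) = c
      revert a b c; decide
    · simp only [Function.update_apply, rot]; grind

lemma natEps_rot_one (q : ℕ → ZMod 2) {k i : ℕ} (hi : i ≤ k) : natEps (rot 0 k i q) 1 = 0 := by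
  rw [natEps_rot q hi 0, if_pos (by omega), add_zero]
  generalize natEps q i = a
  revert a; decide

/-- The terms of `bMul (BUn _)` that involve the letter `1` cancel. -/
lemma rot_outer (q : ℕ → ZMod 2) (k : ℕ) (w : ℕ → A) :
    ∑ i ∈ Finset.range (k + 1), (sgn (rotSign q k i + faceSign (rot 0 k i q) k 0) •
        natWord K k (face (· * ·) k 0 (rot 1 k i w)) +
      sgn (rotSign q k i + faceSign (rot 0 k i q) k (k + 1)) •
        natWord K k (face (· * ·) k (k + 1) (rot 1 k i w))) = 0 := by
  have hz : ∀ i ≤ k, faceSign (rot 0 k i q) k 0 = 0 := fun i hi => by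
    rw [faceSign, if_pos (Nat.zero_le k)]; exact natEps_rot_one q hi
  have hf : ∀ i, faceSign (rot 0 k i q) k (k + 1) =
      (rot 0 k i q (k + 1) + 1) * natEps (rot 0 k i q) (k + 1) + 1 := fun i => if_neg (by omega)
  have h0 : sgn (rotSign q k k + faceSign (rot 0 k k q) k 0) •
        natWord K k (face (· * ·) k 0 (rot 1 k k w)) +
      sgn (rotSign q k 0 + faceSign (rot 0 k 0 q) k (k + 1)) •
        natWord K k (face (· * ·) k (k + 1) (rot 1 k 0 w)) = 0 := by
    refine sgn_cancel ?_ (natWord_congr fun t ht => ?_)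
    · rw [hz k le_rfl, hf, natEps_rot q (Nat.zero_le k), if_pos (by omega), rotSign, rotSign, rot,
        if_neg (Nat.succ_ne_zero k), if_pos (by omega), show 0 + (k + 1) - 1 = k by omega,
        natEps_succ, natEps_zero, zero_add]
      generalize natEps q k = a
      generalize q k = b
      revert a b; decide
    · simp only [face_merge _ (Nat.zero_le k), face_last, merge, mergeLast, rot]
      grind
  have h1 : ∀ i ∈ Finset.range k, sgn (rotSign q k i + faceSign (rot 0 k i q) k 0) •
        natWord K k (face (· * ·) k 0 (rot 1 k i w)) +
      sgn (rotSign q k (i + 1) + faceSign (rot 0 k (i + 1) q) k (k + 1)) •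
        natWord K k (face (· * ·) k (k + 1) (rot 1 k (i + 1) w)) = 0 := by
    intro i hi
    have hi := Finset.mem_range.1 hi
    refine sgn_cancel ?_ (natWord_congr fun t ht => ?_)
    · have hr : rot 0 k (i + 1) q (k + 1) = q i := by
        rw [rot, if_neg (Nat.succ_ne_zero k), if_neg (by omega)]; congr 1; omega
      rw [hz i hi.le, hf, natEps_rot q hi, hr, rotSign, rotSign]
      by_cases h : i = 0
      · subst h
        rw [if_pos (by omega), show 0 + 1 + k = k + 1 by omega, natEps_succ q 0, natEps_zero]
        generalize natEps q (k + 1) = a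
        generalize q 0 = b
        revert a b; decide
      · rw [if_neg (by omega), show i + 1 + k - (k + 1) = i by omega, natEps_succ q i]
        generalize natEps q (k + 1) = a
        generalize natEps q i = b
        generalize q i = c
        revert a b c; decide
    · simp only [face_merge _ (Nat.zero_le k), face_last, merge, mergeLast, rot]
      grind
  have H1 := Finset.sum_eq_zero h1
  rw [Finset.sum_add_distrib] at H1
  rw [Finset.sum_add_distrib, Finset.sum_range_succ, Finset.sum_range_succ', add_add_add_comm, H1,
    h0, add_zero]

/-- The other terms of `bMul (BUn _)` cancel with the terms of `BUn (bMul _)`. -/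
lemma rot_inner (q : ℕ → ZMod 2) (n : ℕ) (w : ℕ → A) :
    ∑ i ∈ Finset.range (n + 2), ∑ p ∈ Finset.range (n + 1),
        sgn (rotSign q (n + 1) i + faceSign (rot 0 (n + 1) i q) (n + 1) (p + 1)) •
          natWord K (n + 1) (face (· * ·) (n + 1) (p + 1) (rot 1 (n + 1) i w)) +
      ∑ j ∈ Finset.range (n + 2), ∑ i ∈ Finset.range (n + 1),
        sgn (faceSign q n j + rotSign (face (· + ·) n j q) n i) •
          natWord K (n + 1) (rot 1 n i (face (· * ·) n j w)) = 0 := by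
  rw [add_eq_zero_iff_eq_neg, ← Finset.sum_product', ← Finset.sum_product',
    ← Finset.sum_neg_distrib]
  refine Finset.sum_nbij'
    (fun a => if a.1 + a.2 ≤ n then (a.1 + a.2, a.1) else
      if a.1 + a.2 = n + 1 then (n + 1, if a.1 = n + 1 then 0 else a.1) else
        (a.1 + a.2 - (n + 2), a.1 - 1))
    (fun b => if b.1 = n + 1 then (if b.2 = 0 then (n + 1, 0) else (b.2, n + 1 - b.2)) else
      if b.2 ≤ b.1 then (b.2, b.1 - b.2) else (b.2 + 1, b.1 + n + 1 - b.2))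
    ?_ ?_ ?_ ?_ ?_
  · rintro ⟨i, p⟩ h
    simp only [Finset.mem_product, Finset.mem_range] at h ⊢
    split_ifs <;> simp only [] <;> omega
  · rintro ⟨j, i⟩ h
    simp only [Finset.mem_product, Finset.mem_range] at h ⊢
    split_ifs <;> simp only [] <;> omega
  · rintro ⟨i, p⟩ h
    simp only [Finset.mem_product, Finset.mem_range] at h
    dsimp only
    grind
  · rintro ⟨j, i⟩ h
    simp only [Finset.mem_product, Finset.mem_range] at h
    dsimp only
    grind
  · rintro ⟨i, p⟩ h
    simp only [Finset.mem_product, Finset.mem_range] at h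
    obtain ⟨hi, hp⟩ := h
    dsimp only
    rw [← add_eq_zero_iff_eq_neg]
    have hi' : i ≤ n + 1 := by omega
    have hfs : faceSign (rot 0 (n + 1) i q) (n + 1) (p + 1) =
        natEps (rot 0 (n + 1) i q) (p + 1 + 1) := if_pos (by omega)
    rw [hfs, natEps_rot q hi', face_merge _ (by omega : p + 1 ≤ n + 1)]
    by_cases h1 : i + p ≤ n
    · rw [if_pos h1, if_pos (by omega)]
      refine sgn_cancel ?_ (natWord_congr fun t ht => ?_)
      · rw [rotSign, rotSign, faceSign, if_pos h1, natEps_face_merge q h1, natEps_face_merge q h1,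
          if_pos (by omega), if_neg (by omega), ← add_assoc i p 1]
        generalize natEps q i = a
        generalize natEps q (n + 1 + 1) = b
        generalize natEps q (i + p + 1) = c
        revert a b c; decide
      · rw [face_merge _ h1]
        simp only [merge, rot]
        grind
    · rw [if_neg h1]
      by_cases h2 : i + p = n + 1
      · rw [if_pos h2, if_pos (by omega)]
        have hl : faceSign q n (n + 1) = (q (n + 1) + 1) * natEps q (n + 1) + 1 :=
          if_neg (by omega)
        by_cases h3 : i = n + 1
        · obtain rfl : p = 0 := by omega
          subst h3
          rw [if_pos rfl]
          refine sgn_cancel ?_ (natWord_congr fun t ht => ?_)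
          · rw [hl, rotSign, rotSign, natEps_face_last, zero_add, natEps_succ q (n + 1), face_last,
              natEps_zero]
            generalize natEps q (n + 1) = a
            generalize q (n + 1) = b
            revert a b; decide
          · simp only [face_last, mergeLast, merge, rot]
            grind
        · rw [if_neg h3]
          refine sgn_cancel ?_ (natWord_congr fun t ht => ?_)
          · obtain ⟨i, rfl⟩ : ∃ i', i = i' + 1 := ⟨i - 1, by omega⟩
            rw [hl, rotSign, rotSign, natEps_face_last, natEps_face_last, ← add_assoc (i + 1) p 1,
              h2, natEps_succ q (n + 1)]
            generalize natEps q (n + 1) = a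
            generalize q (n + 1) = b
            generalize natEps q (i + 1) = c
            revert a b c; decide
          · simp only [face_last, mergeLast, merge, rot]
            grind
      · rw [if_neg h2, if_neg (by omega)]
        have h4 : i + p - (n + 2) ≤ n := by omega
        refine sgn_cancel ?_ (natWord_congr fun t ht => ?_)
        · obtain ⟨i, rfl⟩ : ∃ i', i = i' + 1 := ⟨i - 1, by omega⟩
          rw [rotSign, rotSign, faceSign, if_pos h4, natEps_face_merge q h4,
            natEps_face_merge q h4, if_neg (by omega), if_neg (by omega), Nat.add_sub_cancel,
            show i + 1 + (p + 1) - (n + 1 + 1) = i + 1 + p - (n + 2) + 1 by omega]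
          generalize natEps q (n + 1 + 1) = a
          generalize natEps q (i + 1) = b
          generalize natEps q (i + 1 + p - (n + 2) + 1) = c
          revert a b c; decide
        · rw [face_merge _ h4]
          simp only [merge, rot]
          grind

lemma bMul_BUn : bMul 𝒜 ∘ₗ BUn 𝒜 + BUn 𝒜 ∘ₗ bMul 𝒜 = 0 := by
  refine un_ext (𝒜 := 𝒜) fun k w q hw => ?_
  rw [LinearMap.add_apply, LinearMap.comp_apply, LinearMap.comp_apply, LinearMap.zero_apply]
  have hB : bMul 𝒜 (BUn 𝒜 (natWord K k w)) =
      -∑ i ∈ Finset.range (k + 1), ∑ p ∈ Finset.range k,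
        sgn (rotSign q k i + faceSign (rot 0 k i q) k (p + 1)) •
          natWord K k (face (· * ·) k (p + 1) (rot 1 k i w)) := by
    rw [BUn_natWord' k w q hw, map_sum]
    simp only [map_zsmul, fun i => bMul_natWord_face k _ _ (par_rot hw k i), smul_neg,
      Finset.sum_neg_distrib, Finset.smul_sum, smul_smul, ← sgn_add]
    congr 1
    rw [← add_zero (∑ i ∈ Finset.range (k + 1), ∑ p ∈ Finset.range k, _),
      ← rot_outer (K := K) q k w, ← Finset.sum_add_distrib]
    refine Finset.sum_congr rfl fun i _ => ?_
    rw [Finset.sum_range_succ _ (k + 1), Finset.sum_range_succ', add_assoc]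
  rw [hB]
  obtain _ | n := k
  · rw [bMul_natWord_zero, map_zero]; simp
  · rw [bMul_natWord_face n w q hw, map_neg, map_sum]
    simp only [map_zsmul, fun i => BUn_natWord' n _ _ (par_face hw n i), Finset.smul_sum, smul_smul,
      ← sgn_add]
    rw [← neg_add, rot_inner, neg_zero]

lemma bUn_BUn (Ω : NonposCDGA 𝒜) : bUn 𝒜 Ω.d ∘ₗ BUn 𝒜 + BUn 𝒜 ∘ₗ bUn 𝒜 Ω.d = 0 := by
  rw [bUn, LinearMap.add_comp, LinearMap.comp_add, add_add_add_comm, bDiff_BUn, bMul_BUn, add_zero]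

/-! ### Degenerate chains -/

lemma BUn_degen : degen K A ≤ (degen K A).comap (BUn 𝒜) := by
  refine degen_le (𝒜 := 𝒜) fun k w q hw j hj h0 h1 => ?_
  rw [BUn_natWord' k w q hw]
  refine Submodule.sum_mem _ fun i hi => zsmul_mem ?_ _
  have hi := Finset.mem_range.1 hi
  rcases Nat.lt_or_ge j i with h | h
  · refine natWord_mem_degen (j := k + 1 - i + j + 1) (by omega) (by omega) ?_
    simp only [rot]; grind
  · refine natWord_mem_degen (j := j - i + 1) (by omega) (by omega) ?_
    simp only [rot]; grind

lemma BUn_BUn_mem_degen (x : Un K A) : BUn 𝒜 (BUn 𝒜 x) ∈ degen K A := by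
  have : (degen K A).mkQ ∘ₗ BUn 𝒜 ∘ₗ BUn 𝒜 = 0 := by
    refine un_ext (𝒜 := 𝒜) fun k w q hw => ?_
    rw [LinearMap.comp_apply, LinearMap.comp_apply, BUn_natWord' k w q hw, LinearMap.zero_apply,
      Submodule.mkQ_apply, Submodule.Quotient.mk_eq_zero, map_sum]
    refine Submodule.sum_mem _ fun i hi => ?_
    rw [map_zsmul, BUn_natWord' (k + 1) _ _ (par_rot hw k i)]
    refine zsmul_mem (Submodule.sum_mem _ fun j hj => zsmul_mem ?_ _) _
    have hj := Finset.mem_range.1 hj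
    rcases Nat.eq_zero_or_pos j with h | h
    · refine natWord_mem_degen (j := 1) (by omega) (by omega) ?_
      simp only [rot]; grind
    · refine natWord_mem_degen (j := k + 2 - j + 1) (by omega) (by omega) ?_
      simp only [rot]; grind
  simpa using LinearMap.congr_fun this x

lemma bDiff_degen (Ω : NonposCDGA 𝒜) : degen K A ≤ (degen K A).comap (bDiff 𝒜 Ω.d) := by
  refine degen_le (𝒜 := 𝒜) fun k w q hw j hj h0 h1 => ?_
  rw [bDiff_natWord _ k w q hw]
  refine neg_mem (Submodule.sum_mem _ fun i hi => zsmul_mem ?_ _)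
  by_cases h : i = j
  · subst h
    rw [natWord_eq_zero hj (by simp [h1, d_one])]
    exact zero_mem _
  · exact natWord_mem_degen hj h0 (by rw [Function.update_of_ne (Ne.symm h), h1])

lemma bMul_degen : degen K A ≤ (degen K A).comap (bMul 𝒜) := by
  refine degen_le (𝒜 := 𝒜) fun k w q hw j hj h0 h1 => ?_
  obtain _ | k := k
  · omega
  obtain ⟨j, rfl⟩ : ∃ j', j = j' + 1 := ⟨j - 1, by omega⟩
  have hpar : q (j + 1) = 0 ∨ (1 : A) = 0 := by
    have h2 := hw (j + 1)
    rw [h1] at h2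
    have h3 := parityPart_of_mem h2 0
    rw [parityPart_of_mem one_mem_parity, if_pos rfl] at h3
    split_ifs at h3 with h
    · exact Or.inl h.symm
    · exact Or.inr h3
  rcases hpar with hpar | hpar
  swap
  · rw [natWord_eq_zero (j := j + 1) hj (by rw [h1, hpar]), map_zero]; exact zero_mem _
  rw [bMul_natWord_face k w q hw]
  refine neg_mem ?_
  have hsum : ∑ i ∈ Finset.range (k + 2),
      sgn (faceSign q k i) • natWord K k (face (· * ·) k i w) =
      (sgn (faceSign q k j) • natWord K k (face (· * ·) k j w) +
        sgn (faceSign q k (j + 1)) • natWord K k (face (· * ·) k (j + 1) w)) +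
      ∑ i ∈ ((Finset.range (k + 2)).erase j).erase (j + 1),
        sgn (faceSign q k i) • natWord K k (face (· * ·) k i w) := by
    rw [add_assoc, Finset.add_sum_erase _ (fun i => sgn (faceSign q k i) •
        natWord K k (face (· * ·) k i w)) (by simp; omega),
      Finset.add_sum_erase _ (fun i => sgn (faceSign q k i) •
        natWord K k (face (· * ·) k i w)) (by simp; omega)]
  rw [hsum, sgn_cancel, zero_add]
  · refine Submodule.sum_mem _ fun i hi => zsmul_mem ?_ _
    simp only [Finset.mem_erase, Finset.mem_range] at hi
    rcases Nat.lt_or_ge k i with h | h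
    · obtain rfl : i = k + 1 := by omega
      refine natWord_mem_degen (j := j + 1) (by omega) h0 ?_
      rw [face_last, mergeLast, if_neg h0, h1]
    · rcases Nat.lt_or_ge i j with h' | h'
      · refine natWord_mem_degen (j := j) (by omega) (by omega) ?_
        rw [face_merge _ h]; simp only [merge]; grind
      · refine natWord_mem_degen (j := j + 1) (by omega) (by omega) ?_
        rw [face_merge _ h]; simp only [merge]; grind
  · have hj' : j ≤ k := by omega
    rcases Nat.lt_or_ge j k with h | h
    · rw [faceSign, faceSign, if_pos hj', if_pos (by omega), natEps_succ q (j + 1), hpar]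
      generalize natEps q (j + 1) = a
      revert a; decide
    · obtain rfl : j = k := by omega
      rw [faceSign, faceSign, if_pos hj', if_neg (by omega), hpar]
      generalize natEps q (j + 1) = a
      revert a; decide
  · have hj' : j ≤ k := by omega
    refine natWord_congr fun t ht => ?_
    rcases Nat.lt_or_ge j k with h | h
    · rw [face_merge _ hj', face_merge _ (by omega)]
      simp only [merge]; grind
    · obtain rfl : j = k := by omega
      rw [face_merge _ hj', face_last]
      simp only [merge, mergeLast]; grind

lemma bUn_degen (Ω : NonposCDGA 𝒜) : degen K A ≤ (degen K A).comap (bUn 𝒜 Ω.d) := by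
  intro x hx
  rw [Submodule.mem_comap, bUn, LinearMap.add_apply]
  exact add_mem (bDiff_degen Ω hx) (bMul_degen hx)

/-! ### The grading of the chains -/

lemma sum_merge (e : ℕ → ℤ) (i j : ℕ) : ∑ t ∈ Finset.range j, merge (· + ·) i e t =
    if j ≤ i then ∑ t ∈ Finset.range j, e t else ∑ t ∈ Finset.range (j + 1), e t := by
  induction j with
  | zero => simp
  | succ j ih =>
    rw [Finset.sum_range_succ, ih, merge]
    rcases lt_trichotomy j i with h | h | h
    · rw [if_pos h.le, if_pos h, if_pos (by omega), Finset.sum_range_succ]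
    · subst h
      rw [if_pos le_rfl, if_neg (lt_irrefl _), if_pos rfl, if_neg (by omega),
        Finset.sum_range_succ _ (j + 1), Finset.sum_range_succ _ j, add_assoc]
    · rw [if_neg (by omega), if_neg (by omega), if_neg (by omega), if_neg (by omega),
        Finset.sum_range_succ _ (j + 1)]

lemma sum_rot (e : ℕ → ℤ) {k i : ℕ} (hi : i ≤ k) (j : ℕ) :
    ∑ t ∈ Finset.range (j + 1), rot 0 k i e t = if i + j ≤ k + 1 then
      ∑ t ∈ Finset.range (i + j), e t - ∑ t ∈ Finset.range i, e t else
      ∑ t ∈ Finset.range (k + 1), e t - ∑ t ∈ Finset.range i, e t +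
        ∑ t ∈ Finset.range (i + j - (k + 1)), e t := by
  induction j with
  | zero => rw [if_pos (by omega)]; simp [rot]
  | succ j ih =>
    have hr : rot 0 k i e (j + 1) =
        if i + (j + 1) ≤ k + 1 then e (i + j) else e (i + j - (k + 1)) := by
      rw [rot, if_neg (Nat.succ_ne_zero j)]; rfl
    rw [Finset.sum_range_succ, ih, hr]
    rcases lt_trichotomy (i + j) (k + 1) with h | h | h
    · rw [if_pos h.le, if_pos (by omega : i + (j + 1) ≤ k + 1), if_pos (by omega),
        ← add_assoc i j 1, Finset.sum_range_succ]
      ring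
    · rw [if_pos h.le, if_neg (by omega : ¬ i + (j + 1) ≤ k + 1), if_neg (by omega), h,
        show i + (j + 1) - (k + 1) = 1 by omega, Nat.sub_self, Finset.sum_range_one]
    · rw [if_neg (by omega), if_neg (by omega : ¬ i + (j + 1) ≤ k + 1), if_neg (by omega),
        show i + (j + 1) - (k + 1) = (i + j - (k + 1)) + 1 by omega, Finset.sum_range_succ e (_ - _)]
      ring

lemma sum_face (e : ℕ → ℤ) (k : ℕ) {i : ℕ} (hi : i < k + 2) :
    ∑ t ∈ Finset.range (k + 1), face (· + ·) k i e t = ∑ t ∈ Finset.range (k + 2), e t := by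
  rcases Nat.lt_or_ge k i with h | h
  · obtain rfl : i = k + 1 := by omega
    rw [face_last, Finset.sum_range_succ', Finset.sum_range_succ, Finset.sum_range_succ' e]
    simp only [mergeLast, Nat.succ_ne_zero, if_false, if_true]
    ring
  · rw [face_merge _ h, sum_merge, if_neg (by omega)]

lemma sum_update (e : ℕ → ℤ) {k i : ℕ} (hi : i < k) :
    ∑ t ∈ Finset.range k, Function.update e i (e i - 1) t = ∑ t ∈ Finset.range k, e t - 1 := by
  rw [Finset.sum_update_of_mem (Finset.mem_range.2 hi),
    ← Finset.add_sum_erase _ e (Finset.mem_range.2 hi), Finset.sdiff_singleton_eq_erase]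
  ring

lemma bUn_mem (Ω : NonposCDGA 𝒜) {n : ℤ} {x : Un K A} (hx : x ∈ unGr 𝒜 n) :
    bUn 𝒜 Ω.d x ∈ unGr 𝒜 (n - 1) := by
  refine unGr_le (N := (unGr 𝒜 (n - 1)).comap (bUn 𝒜 Ω.d)) (fun k w e hw hn => ?_) hx
  have hp : ∀ j, w j ∈ parity 𝒜 (e j : ZMod 2) := fun j => mem_parity (hw j)
  rw [Submodule.mem_comap, bUn, LinearMap.add_apply]
  refine add_mem ?_ ?_
  · rw [bDiff_natWord _ k w _ hp]
    refine neg_mem (Submodule.sum_mem _ fun i hi => zsmul_mem ?_ _)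
    refine natWord_mem_unGr (e := Function.update e i (e i - 1)) (fun j => ?_) ?_
    · simp only [Function.update_apply]
      split_ifs
      · exact Ω.d_mem (hw i)
      · exact hw j
    · rw [sum_update e (Finset.mem_range.1 hi), ← hn]; ring
  · obtain _ | k := k
    · rw [bMul_natWord_zero]; exact zero_mem _
    rw [bMul_natWord_face k w _ hp]
    refine neg_mem (Submodule.sum_mem _ fun i hi => zsmul_mem ?_ _)
    refine natWord_mem_unGr (e := face (· + ·) k i e) (fun j => ?_) ?_
    · simp only [face, merge, mergeLast]
      split_ifs <;> simp only [merge, mergeLast] <;> split_ifs <;>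
        first | exact hw _ | exact SetLike.mul_mem_graded (hw _) (hw _)
    · rw [sum_face e k (Finset.mem_range.1 hi), ← hn]; push_cast; ring

lemma BUn_mem {n : ℤ} {x : Un K A} (hx : x ∈ unGr 𝒜 n) : BUn 𝒜 x ∈ unGr 𝒜 (n + 1) := by
  refine unGr_le (N := (unGr 𝒜 (n + 1)).comap (BUn 𝒜)) (fun k w e hw hn => ?_) hx
  have hp : ∀ j, w j ∈ parity 𝒜 (e j : ZMod 2) := fun j => mem_parity (hw j)
  rw [Submodule.mem_comap, BUn_natWord' k w _ hp]
  refine Submodule.sum_mem _ fun i hi => zsmul_mem ?_ _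
  have hi := Finset.mem_range.1 hi
  refine natWord_mem_unGr (e := rot 0 k i e) (fun j => ?_) ?_
  · simp only [rot]
    split_ifs
    · exact SetLike.one_mem_graded 𝒜
    · exact hw _
    · exact hw _
  · rw [sum_rot e (Nat.lt_succ_iff.1 hi), ← hn]
    rcases Nat.eq_zero_or_pos i with h | h
    · subst h
      rw [if_pos (by omega), zero_add]; simp; ring
    · rw [if_neg (by omega), Nat.add_sub_cancel]; push_cast; ring

end MixedIdentities

end CyclicBar

/-! ### Homology of graded modules with a differential of degree `-1` -/

section Homology

variable {K : Type*} [Field K] {X Y : Type*} [AddCommGroup X] [Module K X]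
  [AddCommGroup Y] [Module K Y]

/-- The cycles of degree `n` for a differential `D` of degree `-1`. -/
def gradedCycles (gr : ℤ → Submodule K X) (D : X →ₗ[K] X) (n : ℤ) : Submodule K X :=
  gr n ⊓ LinearMap.ker D

/-- The boundaries of degree `n`. -/
def gradedBoundaries (gr : ℤ → Submodule K X) (D : X →ₗ[K] X) (n : ℤ) : Submodule K X :=
  (gr (n + 1)).map D

/-- The homology in degree `n`: cycles modulo boundaries. -/
abbrev gradedHomology (gr : ℤ → Submodule K X) (D : X →ₗ[K] X) (n : ℤ) : Type _ :=
  gradedCycles gr D n ⧸ (gradedBoundaries gr D n).submoduleOf (gradedCycles gr D n)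

/-- The map in homology induced by a linear map that preserves cycles and boundaries. -/
noncomputable def gradedHomologyMap {gr : ℤ → Submodule K X} {D : X →ₗ[K] X}
    {gr' : ℤ → Submodule K Y} {D' : Y →ₗ[K] Y} (f : X →ₗ[K] Y) (m n : ℤ)
    (hc : ∀ x ∈ gradedCycles gr D m, f x ∈ gradedCycles gr' D' n)
    (hb : ∀ x ∈ gradedBoundaries gr D m, f x ∈ gradedBoundaries gr' D' n) :
    gradedHomology gr D m →ₗ[K] gradedHomology gr' D' n :=
  Submodule.mapQ _ _ (f.restrict hc) fun x hx => hb x hx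

end Homology

/-! ### Mixed complexes -/

/-- A mixed complex: graded pieces `gr n` of an ambient space `X`, a differential `b` of degree `-1`
and an operator `B` of degree `+1` with `b² = B² = bB + Bb = 0`. -/
structure MixedComplex (K : Type*) [Field K] (X : Type*) [AddCommGroup X] [Module K X] where
  /-- the graded pieces -/
  gr : ℤ → Submodule K X
  /-- the differential of degree `-1` -/
  b : X →ₗ[K] X
  /-- the operator of degree `+1` -/
  B : X →ₗ[K] X
  b_mem : ∀ {n : ℤ} {x : X}, x ∈ gr n → b x ∈ gr (n - 1)
  B_mem : ∀ {n : ℤ} {x : X}, x ∈ gr n → B x ∈ gr (n + 1)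
  b_b : ∀ x, b (b x) = 0
  B_B : ∀ x, B (B x) = 0
  b_B : ∀ x, b (B x) + B (b x) = 0

namespace MixedComplex

variable {K : Type*} [Field K] {X : Type*} [AddCommGroup X] [Module K X] (M : MixedComplex K X)

/-- The homology of `(gr, b)`; for the cyclic bar complex this is Hochschild homology. -/
abbrev HH (n : ℤ) : Type _ := gradedHomology M.gr M.b n

/-- The degree `n` part of `X[[u]]` with `deg u = -2`: power series `∑ xᵢ uⁱ`, encoded by the
sequence of coefficients, with `xᵢ` of degree `n + 2 i`. -/
def negGr (n : ℤ) : Submodule K (ℕ → X) :=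
  Submodule.pi Set.univ fun i : ℕ => M.gr (n + 2 * i)

/-- Multiplication by `u`. -/
def mulU : (ℕ → X) →ₗ[K] (ℕ → X) :=
  LinearMap.pi fun i => match i with
    | 0 => 0
    | i + 1 => LinearMap.proj i

/-- The differential `b + u B`. -/
def negD : (ℕ → X) →ₗ[K] (ℕ → X) :=
  M.b.compLeft ℕ + mulU ∘ₗ M.B.compLeft ℕ

/-- Negative cyclic homology. -/
abbrev HCneg (n : ℤ) : Type _ := gradedHomology M.negGr M.negD n

variable (K X) in
/-- `x ↦ x u⁰`. -/
def const : X →ₗ[K] (ℕ → X) := LinearMap.single K (fun _ : ℕ => X) 0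

lemma mulU_zero (x : ℕ → X) : mulU (K := K) x 0 = 0 := rfl

lemma mulU_succ (x : ℕ → X) (i : ℕ) : mulU (K := K) x (i + 1) = x i := rfl

lemma negD_zero (x : ℕ → X) : M.negD x 0 = M.b (x 0) := by
  change M.b (x 0) + 0 = _
  rw [add_zero]

lemma negD_succ (x : ℕ → X) (i : ℕ) : M.negD x (i + 1) = M.b (x (i + 1)) + M.B (x i) := rfl

lemma mem_negGr {n : ℤ} {x : ℕ → X} : x ∈ M.negGr n ↔ ∀ i : ℕ, x i ∈ M.gr (n + 2 * i) := by
  simp [negGr, Submodule.mem_pi]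

lemma mulU_mem {n : ℤ} {x : ℕ → X} (hx : x ∈ M.negGr (n + 2)) : mulU (K := K) x ∈ M.negGr n := by
  rw [mem_negGr] at hx ⊢
  rintro (_ | i)
  · exact zero_mem _
  · have := hx i
    rwa [show n + 2 + 2 * (i : ℤ) = n + 2 * ((i + 1 : ℕ) : ℤ) by push_cast; ring] at this

lemma negD_mulU (x : ℕ → X) : M.negD (mulU (K := K) x) = mulU (K := K) (M.negD x) := by
  funext i
  obtain _ | _ | i := i
  · rw [negD_zero, mulU_zero, mulU_zero, map_zero]
  · rw [negD_succ, mulU_succ, mulU_succ, mulU_zero, negD_zero, map_zero, add_zero]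
  · rw [negD_succ, mulU_succ, mulU_succ, mulU_succ, negD_succ]

lemma const_mem {n : ℤ} {x : X} (hx : x ∈ M.gr n) : const K X x ∈ M.negGr n := by
  rw [mem_negGr]
  rintro (_ | i)
  · simpa [const] using hx
  · simp [const]

lemma negD_const {x : X} (hx : M.B x = 0) : M.negD (const K X x) = const K X (M.b x) := by
  funext i
  obtain _ | _ | i := i
  · rw [negD_zero]; simp [const]
  · rw [negD_succ]; simp [const, hx]
  · rw [negD_succ]; simp [const]

/-- The `S`-action `HC⁻_{n+2} → HC⁻_n`: multiplication by `u`. -/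
noncomputable def S (n : ℤ) : M.HCneg (n + 2) →ₗ[K] M.HCneg n :=
  gradedHomologyMap mulU (n + 2) n
    (fun x hx => ⟨M.mulU_mem hx.1, by
      refine LinearMap.mem_ker.2 ?_
      rw [negD_mulU, LinearMap.mem_ker.1 hx.2, map_zero]⟩)
    (by
      rintro _ ⟨y, hy, rfl⟩
      refine ⟨mulU (K := K) y, M.mulU_mem ?_, M.negD_mulU y⟩
      rwa [add_right_comm])

/-- The map `π : HC⁻_n → HH_n` that sets `u = 0`. -/
noncomputable def proj (n : ℤ) : M.HCneg n →ₗ[K] M.HH n :=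
  gradedHomologyMap (LinearMap.proj 0) n n
    (fun x hx => ⟨by simpa using M.mem_negGr.1 hx.1 0, by
      have := congrFun (LinearMap.mem_ker.1 hx.2) 0
      rw [negD_zero] at this
      exact this⟩)
    (by
      rintro _ ⟨y, hy, rfl⟩
      exact ⟨y 0, by simpa using M.mem_negGr.1 hy 0, (M.negD_zero y).symm⟩)

/-- The connecting map `β : HH_n → HC⁻_{n+1}`, `[x] ↦ [B x]`. -/
noncomputable def β (n : ℤ) : M.HH n →ₗ[K] M.HCneg (n + 1) :=
  gradedHomologyMap (const K X ∘ₗ M.B) n (n + 1)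
    (fun x hx => ⟨M.const_mem (M.B_mem hx.1), by
      have h1 := M.b_B x
      rw [LinearMap.mem_ker.1 hx.2, map_zero, add_zero] at h1
      refine LinearMap.mem_ker.2 ?_
      rw [LinearMap.comp_apply, M.negD_const (M.B_B x), h1, map_zero]⟩)
    (by
      rintro _ ⟨y, hy, rfl⟩
      refine ⟨-const K X (M.B y), neg_mem (M.const_mem (M.B_mem hy)), ?_⟩
      rw [map_neg, M.negD_const (M.B_B y), LinearMap.comp_apply, ← map_neg,
        neg_eq_of_add_eq_zero_right (M.b_B y)])

/-- Connes' operator `B = π ∘ β : HH_n → HH_{n+1}` on homology. -/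
noncomputable def connesB (n : ℤ) : M.HH n →ₗ[K] M.HH (n + 1) := M.proj (n + 1) ∘ₗ M.β n

/-- The quotient of a mixed complex by a subspace that is preserved by both operators. -/
def quotient (N : Submodule K X) (hb : N ≤ N.comap M.b) (hB : N ≤ N.comap M.B) :
    MixedComplex K (X ⧸ N) where
  gr n := (M.gr n).map N.mkQ
  b := N.mapQ N M.b hb
  B := N.mapQ N M.B hB
  b_mem := by
    rintro n _ ⟨x, hx, rfl⟩
    exact ⟨M.b x, M.b_mem hx, rfl⟩
  B_mem := by
    rintro n _ ⟨x, hx, rfl⟩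
    exact ⟨M.B x, M.B_mem hx, rfl⟩
  b_b x := by
    obtain ⟨x, rfl⟩ := N.mkQ_surjective x
    simp [M.b_b]
  B_B x := by
    obtain ⟨x, rfl⟩ := N.mkQ_surjective x
    simp [M.B_B]
  b_B x := by
    obtain ⟨x, rfl⟩ := N.mkQ_surjective x
    simp only [Submodule.mkQ_apply, Submodule.mapQ_apply]
    rw [← Submodule.Quotient.mk_add, M.b_B, Submodule.Quotient.mk_zero]

end MixedComplex

/-! ### Hochschild and negative cyclic homology of a DGA -/

namespace NonposCDGA

open CyclicBar

variable {K : Type*} [Field K] {A : Type*} [Ring A] [Algebra K A]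
  {𝒜 : ℤ → Submodule K A} [GradedAlgebra 𝒜] (Ω : NonposCDGA 𝒜)

/-- The homology `H_i(Ω)` of the DGA. -/
abbrev H (i : ℤ) : Type _ := gradedHomology 𝒜 Ω.d i

/-- `H_0(Ω) = K` and `H_{-1}(Ω) = 0`, i.e. `H⁰ = K` and `H¹ = 0` in cohomological grading. -/
structure IsSimplyConnected : Prop where
  finrank_H_zero : Module.finrank K (Ω.H 0) = 1
  subsingleton_H_neg_one : Subsingleton (Ω.H (-1))

/-- Each `H_i(Ω)` is finite dimensional. -/
def IsLocallyFinite : Prop := ∀ i : ℤ, FiniteDimensional K (Ω.H i)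

/-- The cyclic bar complex `(C(Ω), b, B)`, on normalised chains. -/
noncomputable def cyclicBar : MixedComplex K (Chains K A) where
  gr n := (unGr 𝒜 n).map (degen K A).mkQ
  b := (degen K A).mapQ (degen K A) (bUn 𝒜 Ω.d) (bUn_degen Ω)
  B := (degen K A).mapQ (degen K A) (BUn 𝒜) BUn_degen
  b_mem := by
    rintro n _ ⟨x, hx, rfl⟩
    exact ⟨bUn 𝒜 Ω.d x, bUn_mem Ω hx, rfl⟩
  B_mem := by
    rintro n _ ⟨x, hx, rfl⟩
    exact ⟨BUn 𝒜 x, BUn_mem hx, rfl⟩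
  b_b x := by
    obtain ⟨x, rfl⟩ := (degen K A).mkQ_surjective x
    have := LinearMap.congr_fun (bUn_bUn Ω) x
    rw [LinearMap.comp_apply, LinearMap.zero_apply] at this
    simp [this]
  B_B x := by
    obtain ⟨x, rfl⟩ := (degen K A).mkQ_surjective x
    exact (Submodule.Quotient.mk_eq_zero _).2 (BUn_BUn_mem_degen x)
  b_B x := by
    obtain ⟨x, rfl⟩ := (degen K A).mkQ_surjective x
    have := LinearMap.congr_fun (bUn_BUn Ω) x
    rw [LinearMap.add_apply, LinearMap.comp_apply, LinearMap.comp_apply,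
      LinearMap.zero_apply] at this
    simp only [Submodule.mkQ_apply, Submodule.mapQ_apply]
    rw [← Submodule.Quotient.mk_add, this, Submodule.Quotient.mk_zero]

/-- The image of `C(K)` in `C(Ω)` under the unit `K → Ω`: the multiples of the chain `(1)`. -/
noncomputable def unitChains (K : Type*) [Field K] (A : Type*) [Ring A] [Algebra K A] :
    Submodule K (Chains K A) :=
  Submodule.span K {(degen K A).mkQ (word K A 0 fun _ => 1)}

lemma unitChains_b : unitChains K A ≤ (unitChains K A).comap Ω.cyclicBar.b := by
  refine Submodule.span_le.2 ?_
  rintro _ rfl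
  have h : bUn 𝒜 Ω.d (natWord K 0 fun _ => 1) = 0 := by
    rw [bUn, LinearMap.add_apply, bMul_natWord_zero,
      bDiff_natWord _ 0 _ (fun _ => 0) (fun _ => one_mem_parity)]
    simp [natWord_eq_zero (K := K) (k := 0) (j := 0) le_rfl
      (show Function.update (fun _ : ℕ => (1 : A)) 0 (Ω.d 1) 0 = 0 by simp [d_one])]
  change (degen K A).mkQ (bUn 𝒜 Ω.d (natWord K 0 fun _ => 1)) ∈ unitChains K A
  rw [h, map_zero]
  exact zero_mem _

lemma unitChains_B : unitChains K A ≤ (unitChains K A).comap Ω.cyclicBar.B := by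
  refine Submodule.span_le.2 ?_
  rintro _ rfl
  have h : BUn 𝒜 (natWord K 0 fun _ => 1) ∈ degen K A := by
    rw [BUn_natWord 0 _ (fun _ => 0) (fun _ => one_mem_parity)]
    refine Submodule.sum_mem _ fun i _ => zsmul_mem ?_ _
    exact natWord_mem_degen (j := 1) le_rfl one_ne_zero (by simp [rot])
  change (degen K A).mkQ (BUn 𝒜 (natWord K 0 fun _ => 1)) ∈ unitChains K A
  rw [Submodule.mkQ_apply, (Submodule.Quotient.mk_eq_zero _).2 h]
  exact zero_mem _

/-- The reduced cyclic bar complex `C(Ω) / C(K)`. -/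
noncomputable def reducedCyclicBar : MixedComplex K (Chains K A ⧸ unitChains K A) :=
  Ω.cyclicBar.quotient (unitChains K A) Ω.unitChains_b Ω.unitChains_B

/-- `Ω` is Batalin–Vilkovisky exact: the image of Connes' operator on reduced Hochschild homology
is its kernel, in every degree. -/
def IsBVExact : Prop :=
  ∀ n : ℤ, LinearMap.range (Ω.reducedCyclicBar.connesB n) =
    LinearMap.ker (Ω.reducedCyclicBar.connesB (n + 1))

/-- The `S`-action `HC⁻_{n+2} → HC⁻_n` on reduced negative cyclic homology. -/
noncomputable def reducedS (n : ℤ) :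
    Ω.reducedCyclicBar.HCneg (n + 2) →ₗ[K] Ω.reducedCyclicBar.HCneg n :=
  Ω.reducedCyclicBar.S n

end NonposCDGA

/-!
# BV exactness and the `S`-action on reduced negative cyclic homology

Setting `u = 0` in `C[[u]]` yields the exact Gysin sequence
`HC⁻_{n+2} → HC⁻_n → HH_n → HC⁻_{n+1}` with maps `S`, `π`, `β`, and Connes' operator on homology is
`π ∘ β`. The argument is carried out on cycles.

If `S = 0`, then `π` is injective and `β` is surjective, so
`ker (π ∘ β) = ker β = im π = im (π ∘ β)` (`MixedComplex.range_connesB_eq_ker_of_S_eq_zero`). This holds for every mixed complex.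

Conversely, let `im (π ∘ β) = ker (π ∘ β)`. For a class `x` of `HC⁻` one has `β (π x) = 0`, so
`π x = π (β y)` for some `y`, and `x - β y` lies in the image of `S`. As `S ∘ β = 0`, this gives
`im S = im S²` (`MixedComplex.exists_mulU_sub_mulU_mulU`), so elements of `im S` are divisible by
all powers of `S`. They vanish as soon as `HC⁻_n = 0` for `n > 0`, and this follows from
`HH_n = 0` for `n > 0` by solving for the coefficients of a primitive one by one
(`MixedComplex.exists_negD_eq`).

The vanishing of reduced Hochschild homology in positive degrees is where simple connectedness is
used. Since `H_0 = K` and `H_{-1} = 0`, there is a homotopy `h` on the algebra such that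
`p = 1 - (dh + hd)` has values in the scalars in degree `0` and vanishes in degree `-1`
(`NonposCDGA.IsSimplyConnected.exists_homotopy`). It induces a homotopy on words
(`CyclicBar.bDiff_tensorHomotopy`), which contracts the complex, up to shorter words, onto the
words with letters in the image of `p`. In such a word all letters after the first have degree at
most `-2` unless the word is degenerate, so it has degree at most `0`
(`CyclicBar.natWord_mem_degen_of_pos`). Induction on the length of words finishes the proof.
-/

/-! ### Negative cyclic homology of a mixed complex -/

section GradedHomology

variable {K : Type*} [Field K] {X Y : Type*} [AddCommGroup X] [Module K X]
  [AddCommGroup Y] [Module K Y]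

lemma gradedHomology_mk_eq_zero {gr : ℤ → Submodule K X} {D : X →ₗ[K] X} {n : ℤ}
    (x : gradedCycles gr D n) :
    (Submodule.Quotient.mk x : gradedHomology gr D n) = 0 ↔ ∃ y ∈ gr (n + 1), D y = x := by
  rw [Submodule.Quotient.mk_eq_zero]
  exact Submodule.mem_map

end GradedHomology

namespace MixedComplex

variable {K : Type*} [Field K] {X : Type*} [AddCommGroup X] [Module K X] (M : MixedComplex K X)

lemma const_zero (x : X) : const K X x 0 = x := by simp [const]

lemma const_succ (x : X) (i : ℕ) : const K X x (i + 1) = 0 := by simp [const]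

/-- The connecting map followed by `S` vanishes: `u B x` is the boundary of the cycle `x`. -/
lemma mulU_const_B {x : X} (hx : M.b x = 0) :
    mulU (K := K) (const K X (M.B x)) = M.negD (const K X x) := by
  funext i
  obtain _ | _ | i := i
  · rw [mulU_zero, negD_zero, const_zero, hx]
  · rw [mulU_succ, negD_succ, const_zero, const_zero, const_succ, map_zero, zero_add]
  · rw [mulU_succ, negD_succ, const_succ, const_succ, const_succ, map_zero, map_zero, add_zero]

lemma negD_negD (x : ℕ → X) : M.negD (M.negD x) = 0 := by
  funext i
  obtain _ | _ | i := i
  · rw [negD_zero, negD_zero, M.b_b]; rfl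
  · rw [negD_succ, negD_succ, negD_zero, map_add, M.b_b, zero_add, M.b_B]; rfl
  · rw [negD_succ, negD_succ, negD_succ, map_add, map_add, M.b_b, M.B_B, zero_add, add_zero,
      M.b_B]; rfl

/-- A cycle of `X[[u]]` without constant term is `u` times a cycle. -/
lemma exists_mulU_eq {n : ℤ} {x : ℕ → X} (hx : x ∈ M.negGr n) (hD : M.negD x = 0) (h0 : x 0 = 0) :
    ∃ z ∈ M.negGr (n + 2), M.negD z = 0 ∧ mulU (K := K) z = x := by
  have hz : mulU (K := K) (fun i => x (i + 1)) = x := by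
    funext i
    cases i with
    | zero => rw [mulU_zero, h0]
    | succ i => rw [mulU_succ]
  refine ⟨fun i => x (i + 1), M.mem_negGr.2 fun i => ?_, ?_, hz⟩
  · have := M.mem_negGr.1 hx (i + 1)
    rwa [show n + 2 * ((i + 1 : ℕ) : ℤ) = n + 2 + 2 * (i : ℤ) by push_cast; ring] at this
  · rw [← hz, negD_mulU] at hD
    funext i
    have := congrFun hD (i + 1)
    rwa [mulU_succ] at this

lemma S_eq_zero_iff (n : ℤ) : M.S n = 0 ↔ ∀ x ∈ M.negGr (n + 2), M.negD x = 0 →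
    ∃ y ∈ M.negGr (n + 1), M.negD y = mulU (K := K) x := by
  constructor
  · intro h x hx hD
    exact (gradedHomology_mk_eq_zero (gr := M.negGr) (D := M.negD) (n := n) _).1
      (LinearMap.congr_fun h (Submodule.Quotient.mk ⟨x, hx, hD⟩))
  · intro h
    refine LinearMap.ext fun c => ?_
    obtain ⟨⟨x, hx, hD⟩, rfl⟩ := Submodule.Quotient.mk_surjective _ c
    exact (gradedHomology_mk_eq_zero (gr := M.negGr) (D := M.negD) (n := n) _).2 (h x hx hD)

lemma connesB_mk_eq_zero_iff (n : ℤ) (x : gradedCycles M.gr M.b n) :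
    M.connesB n (Submodule.Quotient.mk x) = 0 ↔ ∃ y ∈ M.gr (n + 1 + 1), M.b y = M.B x := by
  refine (gradedHomology_mk_eq_zero (gr := M.gr) (D := M.b) (n := n + 1) _).trans ?_
  change (∃ y ∈ M.gr (n + 1 + 1), M.b y = const K X (M.B x) 0) ↔ _
  rw [const_zero]

lemma mk_eq_connesB_mk_iff (n : ℤ) (x : gradedCycles M.gr M.b (n + 1))
    (z : gradedCycles M.gr M.b n) :
    M.connesB n (Submodule.Quotient.mk z) = Submodule.Quotient.mk x ↔
      ∃ t ∈ M.gr (n + 1 + 1), M.b t = M.B z - x := by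
  rw [← sub_eq_zero]
  refine (gradedHomology_mk_eq_zero (gr := M.gr) (D := M.b) (n := n + 1) (_ - x)).trans ?_
  change (∃ y ∈ M.gr (n + 1 + 1), M.b y = const K X (M.B z) 0 - x) ↔ _
  rw [const_zero]

/-- Exactness of Connes' operator on homology, in terms of cycles. The inclusion of the image in
the kernel is automatic from `B² = 0`. -/
lemma range_connesB_eq_ker_iff (n : ℤ) :
    LinearMap.range (M.connesB n) = LinearMap.ker (M.connesB (n + 1)) ↔
      ∀ x ∈ M.gr (n + 1), M.b x = 0 → (∃ y ∈ M.gr (n + 1 + 1 + 1), M.b y = M.B x) →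
        ∃ z ∈ M.gr n, M.b z = 0 ∧ ∃ t ∈ M.gr (n + 1 + 1), M.b t = M.B z - x := by
  constructor
  · intro h x hx hb hy
    have h1 := (M.connesB_mk_eq_zero_iff (n + 1) ⟨x, hx, hb⟩).2 hy
    rw [← LinearMap.mem_ker, ← h] at h1
    obtain ⟨c, hc⟩ := h1
    obtain ⟨z, rfl⟩ := Submodule.Quotient.mk_surjective _ c
    exact ⟨z, z.2.1, z.2.2, (M.mk_eq_connesB_mk_iff n _ z).1 hc⟩
  · intro h
    refine le_antisymm ?_ fun c hc => ?_
    · rintro _ ⟨c, rfl⟩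
      obtain ⟨z, rfl⟩ := Submodule.Quotient.mk_surjective _ c
      refine (M.connesB_mk_eq_zero_iff (n + 1) _).2 ⟨0, zero_mem _, ?_⟩
      change M.b 0 = M.B (const K X (M.B z) 0)
      rw [const_zero, M.B_B, map_zero]
    · obtain ⟨⟨x, hx, hb⟩, rfl⟩ := Submodule.Quotient.mk_surjective _ c
      obtain ⟨z, hz, hbz, ht⟩ := h x hx hb ((M.connesB_mk_eq_zero_iff (n + 1) _).1 hc)
      exact ⟨Submodule.Quotient.mk ⟨z, hz, hbz⟩, (M.mk_eq_connesB_mk_iff n _ _).2 ht⟩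

/-- If `S` vanishes, Connes' operator is exact on homology: a class `[x]` with `B [x] = 0` lifts to
negative cyclic homology, and the lift is killed by `S`, hence comes from Hochschild homology. -/
theorem range_connesB_eq_ker_of_S_eq_zero (hS : ∀ n, M.S n = 0) (n : ℤ) :
    LinearMap.range (M.connesB n) = LinearMap.ker (M.connesB (n + 1)) := by
  rw [range_connesB_eq_ker_iff]
  rintro x hx hb ⟨y, hy, hby⟩
  have hBy : M.b (M.B y) = 0 := by
    have := M.b_B y
    rwa [hby, M.B_B, add_zero] at this
  have hBy_mem : const K X (M.B y) ∈ M.negGr (n + 2 + 2) := by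
    refine M.const_mem ?_
    have := M.B_mem hy
    rwa [show n + 1 + 1 + 1 + 1 = n + 2 + 2 by ring] at this
  obtain ⟨v, hv, hDv⟩ := (M.S_eq_zero_iff (n + 2)).1 (hS _) _ hBy_mem (by
    rw [M.negD_const (M.B_B y), hBy, map_zero])
  -- The lift of `[x]` is `x - u (y - v)`.
  have hy' : const K X y ∈ M.negGr (n + 2 + 1) := by
    refine M.const_mem ?_
    rwa [show n + 1 + 1 + 1 = n + 2 + 1 by ring] at hy
  have hDy : M.negD (const K X y - v) = const K X (M.B x) := by
    funext i
    rw [map_sub, hDv, ← hby]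
    obtain _ | _ | i := i
    · rw [Pi.sub_apply, negD_zero, mulU_zero, const_zero, const_zero, sub_zero]
    · rw [Pi.sub_apply, negD_succ, mulU_succ, const_zero, const_zero, const_succ, const_succ,
        map_zero, zero_add, zero_add, sub_self]
    · rw [Pi.sub_apply, negD_succ, mulU_succ, const_succ, const_succ, const_succ, const_succ,
        map_zero, map_zero, add_zero, sub_self]
  have hc : const K X x - mulU (K := K) (const K X y - v) ∈ M.negGr (n - 1 + 2) := by
    rw [show n - 1 + 2 = n + 1 by ring]
    refine sub_mem (M.const_mem hx) (M.mulU_mem ?_)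
    rw [show n + 1 + 2 = n + 2 + 1 by ring]
    exact sub_mem hy' hv
  obtain ⟨z, hz, hDz⟩ := (M.S_eq_zero_iff (n - 1)).1 (hS _) _ hc (by
    rw [map_sub, negD_mulU, hDy, ← M.mulU_const_B hb, sub_self])
  rw [sub_add_cancel] at hz
  have h0 := congrFun hDz 0
  have h1 := congrFun hDz 1
  rw [negD_zero, mulU_zero] at h0
  rw [negD_succ, mulU_succ, Pi.sub_apply, mulU_zero, const_zero, sub_zero] at h1
  refine ⟨z 0, by simpa using M.mem_negGr.1 hz 0, h0, -z 1, neg_mem ?_, ?_⟩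
  · have := M.mem_negGr.1 hz 1
    rwa [show n + 2 * ((1 : ℕ) : ℤ) = n + 1 + 1 by push_cast; ring] at this
  · rw [map_neg, ← h1]; abel

/-- If `(gr, b)` is exact in positive degrees, so is `(X[[u]], b + u B)`: a primitive of a cycle is
found by solving for its coefficients one after the other. -/
lemma exists_negD_eq
    (hex : ∀ n : ℤ, 0 < n → ∀ x ∈ M.gr n, M.b x = 0 → ∃ y ∈ M.gr (n + 1), M.b y = x)
    {n : ℤ} (hn : 0 < n) {x : ℕ → X} (hx : x ∈ M.negGr n) (hD : M.negD x = 0) :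
    ∃ y ∈ M.negGr (n + 1), M.negD y = x := by
  have hex' : ∀ (n : ℤ) (x : X), ∃ y, 0 < n → x ∈ M.gr n → M.b x = 0 →
      y ∈ M.gr (n + 1) ∧ M.b y = x := by
    intro n x
    by_cases h : 0 < n ∧ x ∈ M.gr n ∧ M.b x = 0
    · obtain ⟨y, hy⟩ := hex n h.1 x h.2.1 h.2.2
      exact ⟨y, fun _ _ _ => hy⟩
    · exact ⟨0, fun h1 h2 h3 => (h ⟨h1, h2, h3⟩).elim⟩
  choose c hc using hex'
  -- Solve `b y₀ = x₀` and `b yᵢ₊₁ = xᵢ₊₁ - B yᵢ` in turn.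
  let y : ℕ → X := fun i => Nat.rec (c n (x 0))
    (fun i yi => c (n + 2 * ((i + 1 : ℕ) : ℤ)) (x (i + 1) - M.B yi)) i
  have hx' := M.mem_negGr.1 hx
  have hD0 : M.b (x 0) = 0 := by rw [← negD_zero, hD]; rfl
  have hD1 : ∀ i, M.b (x (i + 1)) + M.B (x i) = 0 := fun i => by rw [← negD_succ, hD]; rfl
  have key : ∀ i : ℕ, y i ∈ M.gr (n + 2 * (i : ℤ) + 1) ∧ M.negD y i = x i := by
    intro i
    induction i with
    | zero =>
      have := hc n (x 0) hn (by simpa using hx' 0) hD0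
      rw [negD_zero]
      refine ⟨?_, this.2⟩
      rw [show n + 2 * ((0 : ℕ) : ℤ) + 1 = n + 1 by simp]
      exact this.1
    | succ i ih =>
      have hBy : M.b (M.B (y i)) = - M.B (M.b (y i)) := eq_neg_of_add_eq_zero_left (M.b_B _)
      have hBb : M.B (M.b (y i)) = M.B (x i) := by
        rw [← ih.2]
        cases i with
        | zero => rw [negD_zero]
        | succ i => rw [negD_succ, map_add, M.B_B, add_zero]
      have := hc (n + 2 * ((i + 1 : ℕ) : ℤ)) (x (i + 1) - M.B (y i)) (by positivity)
        (sub_mem (hx' _) (by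
          have := M.B_mem ih.1
          rwa [show n + 2 * (i : ℤ) + 1 + 1 = n + 2 * ((i + 1 : ℕ) : ℤ) by push_cast; ring]
            at this))
        (by rw [map_sub, hBy, hBb, sub_neg_eq_add, hD1])
      refine ⟨this.1, ?_⟩
      rw [negD_succ]
      exact eq_sub_iff_add_eq.1 this.2
  refine ⟨y, M.mem_negGr.2 fun i => ?_, funext fun i => (key i).2⟩
  rw [add_right_comm]
  exact (key i).1

/-- If Connes' operator is exact on homology, then the image of `S` is the image of `S²`. -/
lemma exists_mulU_sub_mulU_mulU (hB : ∀ n : ℤ, LinearMap.range (M.connesB n) =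
      LinearMap.ker (M.connesB (n + 1))) {n : ℤ} {x : ℕ → X} (hx : x ∈ M.negGr (n + 2))
    (hD : M.negD x = 0) : ∃ z ∈ M.negGr (n + 2 + 2), M.negD z = 0 ∧ ∃ y ∈ M.negGr (n + 1),
      M.negD y = mulU (K := K) x - mulU (K := K) (mulU (K := K) z) := by
  have hx0 : x 0 ∈ M.gr (n + 1 + 1) := by
    have := M.mem_negGr.1 hx 0
    rwa [show n + 2 + 2 * ((0 : ℕ) : ℤ) = n + 1 + 1 by push_cast; ring] at this
  have hb : M.b (x 0) = 0 := by rw [← negD_zero, hD]; rfl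
  have hx1 : x 1 ∈ M.gr (n + 1 + 1 + 1 + 1) := by
    have := M.mem_negGr.1 hx 1
    rwa [show n + 2 + 2 * ((1 : ℕ) : ℤ) = n + 1 + 1 + 1 + 1 by push_cast; ring] at this
  have hD1 : M.b (x 1) + M.B (x 0) = 0 := by rw [← negD_succ, hD]; rfl
  obtain ⟨a, ha, hba, t, ht, hbt⟩ := (M.range_connesB_eq_ker_iff (n + 1)).1 (hB _) (x 0) hx0 hb
    ⟨-x 1, neg_mem hx1, by rw [map_neg, eq_comm]; exact eq_neg_of_add_eq_zero_right hD1⟩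
  have ht' : const K X t ∈ M.negGr (n + 2 + 1) := by
    refine M.const_mem ?_
    rwa [show n + 1 + 1 + 1 = n + 2 + 1 by ring] at ht
  have hBa : const K X (M.B a) ∈ M.negGr (n + 2) := by
    refine M.const_mem ?_
    have := M.B_mem ha
    rwa [show n + 1 + 1 = n + 2 by ring] at this
  have hDt : M.negD (const K X t) ∈ M.negGr (n + 2) := by
    refine M.mem_negGr.2 fun i => ?_
    have h := M.mem_negGr.1 ht'
    cases i with
    | zero => simpa [negD_zero] using M.b_mem (h 0)
    | succ i =>
      rw [negD_succ]
      refine add_mem ?_ ?_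
      · have := M.b_mem (h (i + 1))
        rwa [show n + 2 + 1 + 2 * ((i + 1 : ℕ) : ℤ) - 1 = n + 2 + 2 * ((i + 1 : ℕ) : ℤ) by ring]
          at this
      · have := M.B_mem (h i)
        rwa [show n + 2 + 1 + 2 * (i : ℤ) + 1 = n + 2 + 2 * ((i + 1 : ℕ) : ℤ) by push_cast; ring]
          at this
  -- With `x₀ = B a - b t`, the cycle `x - B a + (b + u B) t` has no constant term, and `u B a` is
  -- the boundary of `a`.
  obtain ⟨z, hz, hDz, hzx⟩ := M.exists_mulU_eq
    (x := x - const K X (M.B a) + M.negD (const K X t)) (add_mem (sub_mem hx hBa) hDt)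
    (by
      rw [map_add, map_sub, hD, M.negD_negD, M.negD_const (M.B_B a), eq_neg_of_add_eq_zero_left
        (M.b_B a), hba]
      simp)
    (by
      rw [Pi.add_apply, Pi.sub_apply, negD_zero, const_zero, const_zero, hbt]; abel)
  refine ⟨z, hz, hDz, const K X a - mulU (K := K) (const K X t), sub_mem (M.const_mem ha)
    (M.mulU_mem ?_), ?_⟩
  · rwa [show n + 1 + 2 = n + 2 + 1 by ring]
  · rw [map_sub, negD_mulU, hzx, map_add, map_sub, M.mulU_const_B hba]; abel

/-- If Connes' operator is exact on homology, and the homology vanishes in positive degrees, then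
`S = 0`: an element of its image is divisible by every power of `S`, and negative cyclic homology
vanishes in positive degrees. -/
theorem S_eq_zero_of_range_connesB_eq_ker
    (hex : ∀ n : ℤ, 0 < n → ∀ x ∈ M.gr n, M.b x = 0 → ∃ y ∈ M.gr (n + 1), M.b y = x)
    (hB : ∀ n : ℤ, LinearMap.range (M.connesB n) = LinearMap.ker (M.connesB (n + 1))) (n : ℤ) :
    M.S n = 0 := by
  suffices H : ∀ (k : ℕ) (n : ℤ), 0 < n + 2 + 2 * (k : ℤ) → ∀ x ∈ M.negGr (n + 2), M.negD x = 0 →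
      ∃ y ∈ M.negGr (n + 1), M.negD y = mulU (K := K) x from
    (M.S_eq_zero_iff n).2 (H n.natAbs n (by omega))
  intro k
  induction k with
  | zero =>
    intro n hn x hx hD
    obtain ⟨y, hy, hDy⟩ := M.exists_negD_eq hex (by simpa using hn) hx hD
    refine ⟨mulU (K := K) y, M.mulU_mem ?_, by rw [negD_mulU, hDy]⟩
    rwa [add_right_comm]
  | succ k ih =>
    intro n hn x hx hD
    obtain ⟨z, hz, hDz, y, hy, hDy⟩ := M.exists_mulU_sub_mulU_mulU hB hx hD
    obtain ⟨v, hv, hDv⟩ := ih (n + 2) (by push_cast at hn; omega) z hz hDz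
    refine ⟨y + mulU (K := K) v, add_mem hy (M.mulU_mem ?_), ?_⟩
    · rwa [add_right_comm]
    · rw [map_add, hDy, negD_mulU, hDv, sub_add_cancel]

/-- Exactness in degree `n` from a filtration `F` of `gr n` and an operator `H` such that `bH + Hb`
is the identity modulo a smaller step of the filtration. -/
lemma exists_b_eq_of_filtration {n : ℤ} (F : ℕ → Submodule K X) (H : X →ₗ[K] X)
    (hF0 : F 0 = ⊥) (hF : M.gr n ≤ ⨆ k, F k) (hmono : Monotone F) (hFn : ∀ k, F k ≤ M.gr n)
    (hH : ∀ x ∈ M.gr n, H x ∈ M.gr (n + 1))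
    (hstep : ∀ k, ∀ x ∈ F (k + 1), x - (M.b (H x) + H (M.b x)) ∈ F k) {x : X} (hx : x ∈ M.gr n)
    (hb : M.b x = 0) : ∃ y ∈ M.gr (n + 1), M.b y = x := by
  obtain ⟨k, hk⟩ := (Submodule.mem_iSup_of_directed F hmono.directed_le).1 (hF hx)
  clear hx
  induction k generalizing x with
  | zero =>
    rw [hF0, Submodule.mem_bot] at hk
    exact ⟨0, zero_mem _, by rw [hk, map_zero]⟩
  | succ k ih =>
    have h1 := hstep k x hk
    rw [hb, map_zero, add_zero] at h1
    obtain ⟨y, hy, hby⟩ := ih (x := x - M.b (H x)) (by rw [map_sub, hb, M.b_b, sub_zero]) h1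
    exact ⟨y + H x, add_mem hy (hH x (hFn _ hk)), by rw [map_add, hby, sub_add_cancel]⟩

end MixedComplex

/-! ### Filtration of the chains by the length of words -/

namespace CyclicBar

section Filtration

variable {K : Type*} [Field K] {A : Type*} [Ring A] [Algebra K A]

/-- The chains of degree `n` spanned by homogeneous words with at most `k` letters. -/
noncomputable def unFil (𝒜 : ℤ → Submodule K A) (n : ℤ) (k : ℕ) : Submodule K (Un K A) :=
  Submodule.span K {x | ∃ (m : ℕ) (w : ℕ → A) (e : ℕ → ℤ), m < k ∧ (∀ j, w j ∈ 𝒜 (e j)) ∧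
    ∑ j ∈ Finset.range (m + 1), e j + m = n ∧ x = natWord K m w}

variable {𝒜 : ℤ → Submodule K A}

lemma natWord_mem_unFil {n : ℤ} {k m : ℕ} (hm : m < k) {w : ℕ → A} {e : ℕ → ℤ}
    (hw : ∀ j, w j ∈ 𝒜 (e j)) (hn : ∑ j ∈ Finset.range (m + 1), e j + m = n) :
    natWord K m w ∈ unFil 𝒜 n k :=
  Submodule.subset_span ⟨m, w, e, hm, hw, hn, rfl⟩

lemma unFil_le {n : ℤ} {k : ℕ} {N : Submodule K (Un K A)}
    (H : ∀ (m : ℕ) (w : ℕ → A) (e : ℕ → ℤ), m < k → (∀ j, w j ∈ 𝒜 (e j)) →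
      ∑ j ∈ Finset.range (m + 1), e j + m = n → natWord K m w ∈ N) : unFil 𝒜 n k ≤ N := by
  refine Submodule.span_le.2 ?_
  rintro _ ⟨m, w, e, hm, hw, hn, rfl⟩
  exact H m w e hm hw hn

lemma unFil_zero (n : ℤ) : unFil 𝒜 n 0 = ⊥ :=
  le_bot_iff.1 (unFil_le fun _ _ _ hm => absurd hm (Nat.not_lt_zero _))

lemma unFil_mono (n : ℤ) : Monotone (unFil 𝒜 n) := fun _ _ hkl =>
  unFil_le fun _ _ _ hm hw hn => natWord_mem_unFil (hm.trans_le hkl) hw hn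

lemma unFil_le_unGr (n : ℤ) (k : ℕ) : unFil 𝒜 n k ≤ unGr 𝒜 n :=
  unFil_le fun _ _ _ _ hw hn => natWord_mem_unGr hw hn

lemma unGr_le_iSup_unFil (n : ℤ) : unGr 𝒜 n ≤ ⨆ k, unFil 𝒜 n k :=
  unGr_le fun k _ _ hw hn => le_iSup (unFil 𝒜 n) (k + 1) (natWord_mem_unFil k.lt_succ_self hw hn)

end Filtration

/-! ### A homotopy on the chains -/

section Homotopy

variable {K : Type*} [Field K] {A : Type*} [Ring A] [Algebra K A]

/-- The endomorphism `1 - (dh + hd)`, which `h` makes chain homotopic to the identity. -/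
def homotopyProj (d h : A →ₗ[K] A) : A →ₗ[K] A := LinearMap.id - (d ∘ₗ h + h ∘ₗ d)

lemma homotopyProj_apply (d h : A →ₗ[K] A) (a : A) :
    homotopyProj d h a = a - (d (h a) + h (d a)) := rfl

/-- The letters `(p w₀, …, p wᵢ₋₁, h wᵢ, wᵢ₊₁, …)`. -/
def homotopyLetters (p h : A → A) (i : ℕ) (w : ℕ → A) : ℕ → A :=
  fun j => if j < i then p (w j) else if j = i then h (w j) else w j

variable (𝒜 : ℤ → Submodule K A) [GradedAlgebra 𝒜]

/-- The operator `(w₀, …, wₖ) ↦ -∑ᵢ (-1)^{εᵢ₋₁} (p w₀, …, p wᵢ₋₁, h wᵢ, wᵢ₊₁, …, wₖ)`: the usual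
homotopy on tensor powers induced by a homotopy `h` between the identity and `p`. -/
noncomputable def tensorHomotopy (p h : A →ₗ[K] A) : Un K A →ₗ[K] Un K A :=
  liftUn fun k =>
    -∑ i : Fin (k + 1), koszul 𝒜 (fun q => eps q (i - 1))
      ((word K A k).compLinearMap
        (fun j => if j < i then p else if j = i then h else LinearMap.id))

variable {𝒜}

lemma tensorHomotopy_natWord (p h : A →ₗ[K] A) (k : ℕ) (w : ℕ → A) (q : ℕ → ZMod 2)
    (hw : ∀ j, w j ∈ parity 𝒜 (q j)) :
    tensorHomotopy 𝒜 p h (natWord K k w) = -∑ i ∈ Finset.range (k + 1),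
      sgn (natEps q i) • natWord K k (homotopyLetters p h i w) := by
  rw [tensorHomotopy, natWord, liftUn_word, neg_apply, sum_apply, Finset.sum_range]
  congr 1
  refine Finset.sum_congr rfl fun i _ => ?_
  rw [koszul_apply _ _ _ (fun j => q j) (fun j => hw j), eps_eq q (by omega)]
  congr 1
  rw [MultilinearMap.compLinearMap_apply, natWord]
  congr 1; funext j
  simp only [homotopyLetters, Fin.ext_iff, Fin.lt_def]
  split_ifs <;> rfl

variable (Ω : NonposCDGA 𝒜) {h : A →ₗ[K] A}

lemma homotopyProj_d (a : A) : homotopyProj Ω.d h (Ω.d a) = Ω.d (homotopyProj Ω.d h a) := by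
  simp [homotopyProj_apply, Ω.d_d]

lemma homotopyProj_mem (hh : ∀ {i : ℤ} {a : A}, a ∈ 𝒜 i → h a ∈ 𝒜 (i + 1)) {i : ℤ} {a : A}
    (ha : a ∈ 𝒜 i) : homotopyProj Ω.d h a ∈ 𝒜 i := by
  have h1 := Ω.d_mem (hh ha)
  have h2 := hh (Ω.d_mem ha)
  rw [add_sub_cancel_right] at h1
  rw [sub_add_cancel] at h2
  exact sub_mem ha (add_mem h1 h2)

lemma homotopyLetters_mem (hh : ∀ {i : ℤ} {a : A}, a ∈ 𝒜 i → h a ∈ 𝒜 (i + 1)) {w : ℕ → A}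
    {e : ℕ → ℤ} (hw : ∀ j, w j ∈ 𝒜 (e j)) (i j : ℕ) :
    homotopyLetters (homotopyProj Ω.d h) h i w j ∈ 𝒜 (Function.update e i (e i + 1) j) := by
  simp only [homotopyLetters, Function.update_apply]
  rcases lt_trichotomy j i with hji | rfl | hji
  · rw [if_pos hji, if_neg hji.ne]; exact homotopyProj_mem Ω hh (hw j)
  · rw [if_neg (lt_irrefl j), if_pos rfl, if_pos rfl]; exact hh (hw j)
  · rw [if_neg hji.not_gt, if_neg hji.ne', if_neg hji.ne']; exact hw j

lemma tensorHomotopy_mem (hh : ∀ {i : ℤ} {a : A}, a ∈ 𝒜 i → h a ∈ 𝒜 (i + 1)) {n : ℤ} {x : Un K A}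
    (hx : x ∈ unGr 𝒜 n) : tensorHomotopy 𝒜 (homotopyProj Ω.d h) h x ∈ unGr 𝒜 (n + 1) := by
  refine unGr_le (N := (unGr 𝒜 (n + 1)).comap (tensorHomotopy 𝒜 (homotopyProj Ω.d h) h))
    (fun k w e hw hn => ?_) hx
  rw [Submodule.mem_comap, tensorHomotopy_natWord _ _ k w _ fun j => mem_parity (hw j)]
  refine neg_mem (Submodule.sum_mem _ fun i hi => zsmul_mem ?_ _)
  refine natWord_mem_unGr (homotopyLetters_mem Ω hh hw i) ?_
  rw [Finset.sum_update_of_mem hi, ← hn, ← Finset.add_sum_erase _ e hi,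
    Finset.sdiff_singleton_eq_erase]
  ring

lemma tensorHomotopy_degen (h1 : h 1 = 0) : degen K A ≤
    (degen K A).comap (tensorHomotopy 𝒜 (homotopyProj Ω.d h) h) := by
  refine degen_le (𝒜 := 𝒜) fun k w q hw j hj h0 hj1 => ?_
  rw [tensorHomotopy_natWord _ _ k w q hw]
  refine neg_mem (Submodule.sum_mem _ fun i hi => zsmul_mem ?_ _)
  rcases lt_trichotomy j i with hji | rfl | hji
  · refine natWord_mem_degen hj h0 ?_
    simp [homotopyLetters, hji, hj1, homotopyProj_apply, h1, d_one]
  · rw [natWord_eq_zero hj (by simp [homotopyLetters, hj1, h1])]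
    exact zero_mem _
  · refine natWord_mem_degen hj h0 ?_
    simp [homotopyLetters, hji.not_gt, hji.ne', hj1]

/-- `bDiff` and `tensorHomotopy` contract the chains onto the words in the image of
`1 - (dh + hd)`. In the double sum over the positions of `d` and of `h` the terms off the diagonal
cancel, and the diagonal telescopes. -/
lemma bDiff_tensorHomotopy (hh : ∀ {i : ℤ} {a : A}, a ∈ 𝒜 i → h a ∈ 𝒜 (i + 1)) (k : ℕ) {w : ℕ → A}
    {e : ℕ → ℤ} (hw : ∀ j, w j ∈ 𝒜 (e j)) :
    bDiff 𝒜 Ω.d (tensorHomotopy 𝒜 (homotopyProj Ω.d h) h (natWord K k w)) +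
      tensorHomotopy 𝒜 (homotopyProj Ω.d h) h (bDiff 𝒜 Ω.d (natWord K k w)) =
      natWord K k w - natWord K k (fun j => homotopyProj Ω.d h (w j)) := by
  set p := homotopyProj Ω.d h with hp
  set q : ℕ → ZMod 2 := fun j => e j with hq
  have hpar : ∀ j, w j ∈ parity 𝒜 (q j) := fun j => mem_parity (hw j)
  have hpar' : ∀ i j, homotopyLetters p h i w j ∈ parity 𝒜 (Function.update q i (q i + 1) j) := by
    intro i j
    have := mem_parity (homotopyLetters_mem Ω hh hw i j)
    simp only [Function.update_apply] at this ⊢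
    split_ifs at this ⊢
    · rwa [Int.cast_add, Int.cast_one] at this
    · exact this
  rw [tensorHomotopy_natWord p h k w q hpar, bDiff_natWord Ω.d k w q hpar, map_neg, map_neg,
    map_sum, map_sum]
  simp only [map_zsmul, fun i => bDiff_natWord Ω.d k _ _ (hpar' i),
    fun i => tensorHomotopy_natWord p h k _ _ (par_update Ω hpar i), smul_neg,
    Finset.sum_neg_distrib, neg_neg, Finset.smul_sum, smul_smul, ← sgn_add, natEps_update]
  rw [Finset.sum_comm (s := Finset.range (k + 1)) (t := Finset.range (k + 1))
    (f := fun j i => sgn (natEps q j + (natEps q i + if j < i then 1 else 0)) •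
      natWord K k (homotopyLetters p h i (Function.update w j (Ω.d (w j))))),
    ← Finset.sum_add_distrib]
  simp only [← Finset.sum_add_distrib]
  -- The words with `p` in front of the first `i` letters.
  let T : ℕ → Un K A := fun i => natWord K k (fun j => if j < i then p (w j) else w j)
  have hdiag : ∀ i ∈ Finset.range (k + 1), ∑ j ∈ Finset.range (k + 1),
      (sgn (natEps q i + (natEps q j + if i < j then 1 else 0)) •
        natWord K k (Function.update (homotopyLetters p h i w) j
          (Ω.d (homotopyLetters p h i w j))) +
      sgn (natEps q j + (natEps q i + if j < i then 1 else 0)) •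
        natWord K k (homotopyLetters p h i (Function.update w j (Ω.d (w j))))) =
      T i - T (i + 1) := by
    intro i hi
    have hik := Nat.lt_succ_iff.1 (Finset.mem_range.1 hi)
    rw [Finset.sum_eq_single_of_mem i hi fun j _ hji => ?_]
    · have hs : sgn (natEps q i + (natEps q i + if i < i then 1 else 0)) = 1 := by
        rw [if_neg (lt_irrefl i)]
        generalize natEps q i = a
        revert a; decide
      rw [hs, one_smul, one_smul, eq_sub_iff_add_eq, eq_comm]
      have e1 := natWord_add (K := K) (k := k) (j := i)
        (w := fun j => if j < i then p (w j) else if j = i then w i - p (w i) else w j)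
        (w' := Function.update (homotopyLetters p h i w) i (Ω.d (homotopyLetters p h i w i)))
        (w'' := homotopyLetters p h i (Function.update w i (Ω.d (w i)))) hik
        (by simp [homotopyLetters, hp, homotopyProj_apply])
        (fun t _ ht => by simp [homotopyLetters, ht])
        (fun t _ ht => by simp [homotopyLetters, ht])
      rw [← e1]
      refine natWord_add hik (by simp) (fun t _ ht => by simp [ht]) (fun t _ ht => ?_)
      have : t < i + 1 ↔ t < i := by omega
      simp only [this]
    · refine sgn_cancel ?_ (natWord_congr fun t _ => ?_)
      · rcases lt_or_gt_of_ne hji with hlt | hlt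
        · rw [if_pos hlt, if_neg (by omega)]
          generalize natEps q i = a
          generalize natEps q j = b
          revert a b; decide
        · rw [if_pos hlt, if_neg (by omega)]
          generalize natEps q i = a
          generalize natEps q j = b
          revert a b; decide
      · have := homotopyProj_d (h := h) Ω (w j)
        rw [← hp] at this
        simp only [Function.update_apply, homotopyLetters]
        grind
  rw [Finset.sum_congr rfl hdiag, Finset.sum_range_sub']
  congr 1
  exact natWord_congr fun t ht => if_pos (by omega)

/-- Multiplying letters shortens a word. -/
lemma bMul_mem_unFil {n : ℤ} {k : ℕ} {x : Un K A} (hx : x ∈ unFil 𝒜 n (k + 1)) :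
    bMul 𝒜 x ∈ unFil 𝒜 (n - 1) k := by
  refine unFil_le (N := (unFil 𝒜 (n - 1) k).comap (bMul 𝒜)) (fun m w e hm hw hn => ?_) hx
  rw [Submodule.mem_comap]
  obtain _ | m := m
  · rw [bMul_natWord_zero]; exact zero_mem _
  rw [bMul_natWord_face m w _ fun j => mem_parity (hw j)]
  refine neg_mem (Submodule.sum_mem _ fun i hi => zsmul_mem ?_ _)
  refine natWord_mem_unFil (e := face (· + ·) m i e) (by omega) (fun j => ?_) ?_
  · rw [face, face]
    split_ifs
    · simp only [merge]
      split_ifs <;> first | exact hw _ | exact SetLike.mul_mem_graded (hw _) (hw _)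
    · simp only [mergeLast]
      split_ifs <;> first | exact hw _ | exact SetLike.mul_mem_graded (hw _) (hw _)
  · rw [sum_face e m (Finset.mem_range.1 hi), ← hn]; push_cast; ring

lemma tensorHomotopy_mem_unFil (hh : ∀ {i : ℤ} {a : A}, a ∈ 𝒜 i → h a ∈ 𝒜 (i + 1)) {n : ℤ} {k : ℕ}
    {x : Un K A} (hx : x ∈ unFil 𝒜 n k) :
    tensorHomotopy 𝒜 (homotopyProj Ω.d h) h x ∈ unFil 𝒜 (n + 1) k := by
  refine unFil_le (N := (unFil 𝒜 (n + 1) k).comap (tensorHomotopy 𝒜 (homotopyProj Ω.d h) h))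
    (fun m w e hm hw hn => ?_) hx
  rw [Submodule.mem_comap, tensorHomotopy_natWord _ _ m w _ fun j => mem_parity (hw j)]
  refine neg_mem (Submodule.sum_mem _ fun i hi => zsmul_mem ?_ _)
  refine natWord_mem_unFil hm (homotopyLetters_mem Ω hh hw i) ?_
  rw [Finset.sum_update_of_mem hi, ← hn, ← Finset.add_sum_erase _ e hi,
    Finset.sdiff_singleton_eq_erase]
  ring

/-- A word of positive degree is degenerate if its letters of degree `0` are scalars and it has no
letters of degree `-1`: otherwise all letters but the first have degree at most `-2`, and the degree
of the word is at most minus the number of these letters. -/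
lemma natWord_mem_degen_of_pos (Ω : NonposCDGA 𝒜) {n : ℤ} (hn0 : 0 < n) {k : ℕ} {w : ℕ → A}
    {e : ℕ → ℤ} (hw : ∀ j, w j ∈ 𝒜 (e j))
    (hn : ∑ j ∈ Finset.range (k + 1), e j + k = n)
    (h0 : ∀ j, e j = 0 → ∃ c : K, w j = c • 1) (h1 : ∀ j, e j = -1 → w j = 0) :
    natWord K k w ∈ degen K A := by
  by_cases hz : ∃ j ≤ k, w j = 0
  · obtain ⟨j, hj, hj0⟩ := hz
    rw [natWord_eq_zero hj hj0]; exact zero_mem _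
  push Not at hz
  have hle : ∀ j ≤ k, e j ≤ 0 := by
    intro j hj
    by_contra hpos
    have := hw j
    rw [Ω.nonpos (not_le.1 hpos), Submodule.mem_bot] at this
    exact hz j hj this
  obtain ⟨j, hjk, hj⟩ : ∃ j < k, e (j + 1) = 0 := by
    by_contra! hne
    have hsum : ∑ j ∈ Finset.range k, e (j + 1) ≤ ∑ _j ∈ Finset.range k, (-2 : ℤ) := by
      refine Finset.sum_le_sum fun j hj => ?_
      have hjk := Finset.mem_range.1 hj
      have := hle (j + 1) (by omega)
      have := hne j hjk
      have : e (j + 1) ≠ -1 := fun he => hz (j + 1) (by omega) (h1 _ he)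
      omega
    rw [Finset.sum_const, Finset.card_range, nsmul_eq_mul] at hsum
    rw [Finset.sum_range_succ'] at hn
    have := hle 0 (Nat.zero_le k)
    omega
  obtain ⟨c, hc⟩ := h0 (j + 1) hj
  have key : (fun i : Fin (k + 1) => w i) = Function.update (fun i : Fin (k + 1) => w i)
      ⟨j + 1, by omega⟩ (c • 1) := by
    funext i
    rw [Function.update_apply]
    split_ifs with hi
    · rw [hi]; exact hc
    · rfl
  rw [natWord, key, MultilinearMap.map_update_smul]
  exact Submodule.smul_mem _ _ (Submodule.subset_span
    ⟨k, _, ⟨j + 1, by omega⟩, by simp [Fin.ext_iff], Function.update_self .., rfl⟩)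

end Homotopy

end CyclicBar

/-! ### Vanishing of reduced Hochschild homology in positive degrees -/

lemma LinearMap.exists_comp_comp_eq_self {K V W : Type*} [Field K] [AddCommGroup V] [Module K V]
    [AddCommGroup W] [Module K W] (f : V →ₗ[K] W) : ∃ g : W →ₗ[K] V, ∀ v, f (g (f v)) = f v := by
  obtain ⟨s, hs⟩ := f.rangeRestrict.exists_rightInverse_of_surjective f.range_rangeRestrict
  obtain ⟨g, hg⟩ := s.exists_extend
  refine ⟨g, fun v => ?_⟩
  have h1 := LinearMap.congr_fun hg (f.rangeRestrict v)
  have h2 := congrArg Subtype.val (LinearMap.congr_fun hs (f.rangeRestrict v))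
  change g (f v) = s (f.rangeRestrict v) at h1
  rw [h1]
  exact h2

namespace NonposCDGA

open CyclicBar

variable {K : Type*} [Field K] {A : Type*} [Ring A] [Algebra K A]
  {𝒜 : ℤ → Submodule K A} [GradedAlgebra 𝒜] (Ω : NonposCDGA 𝒜)

variable {Ω}

lemma IsSimplyConnected.exists_smul_one (hsc : Ω.IsSimplyConnected) {a : A} (ha : a ∈ 𝒜 0)
    (hd : Ω.d a = 0) : ∃ c : K, a = c • 1 := by
  have hbot : 𝒜 (0 + 1) = ⊥ := Ω.nonpos (by norm_num)
  have h1 : (1 : A) ∈ gradedCycles 𝒜 Ω.d 0 := ⟨SetLike.one_mem_graded 𝒜, d_one Ω⟩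
  have hinj : ∀ x : gradedCycles 𝒜 Ω.d 0, (Submodule.Quotient.mk x : Ω.H 0) = 0 → (x : A) = 0 := by
    intro x hx
    obtain ⟨y, hy, hyx⟩ := (gradedHomology_mk_eq_zero x).1 hx
    rw [hbot, Submodule.mem_bot] at hy
    rw [← hyx, hy, map_zero]
  have hne : (Submodule.Quotient.mk ⟨1, h1⟩ : Ω.H 0) ≠ 0 := by
    intro h0
    have h10 : (1 : A) = 0 := hinj _ h0
    have : Subsingleton A := subsingleton_of_zero_eq_one h10.symm
    have : Subsingleton (Ω.H 0) := (Submodule.mkQ_surjective _).subsingleton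
    have := hsc.finrank_H_zero
    rw [Module.finrank_zero_of_subsingleton] at this
    exact zero_ne_one this
  obtain ⟨c, hc⟩ := (finrank_eq_one_iff_of_nonzero' _ hne).1 hsc.finrank_H_zero
    (Submodule.Quotient.mk ⟨a, ha, hd⟩)
  refine ⟨c, ?_⟩
  have := hinj (⟨a, ha, hd⟩ - c • ⟨1, h1⟩) (by
    rw [Submodule.Quotient.mk_sub, Submodule.Quotient.mk_smul, hc, sub_self])
  exact sub_eq_zero.1 this

lemma IsSimplyConnected.exists_d_eq (hsc : Ω.IsSimplyConnected) {a : A} (ha : a ∈ 𝒜 (-1))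
    (hd : Ω.d a = 0) : ∃ v ∈ 𝒜 0, Ω.d v = a := by
  have := hsc.subsingleton_H_neg_one
  exact (gradedHomology_mk_eq_zero (gr := 𝒜) (D := Ω.d) (n := -1) ⟨a, ha, hd⟩).1
    (Subsingleton.elim (α := Ω.H (-1)) _ _)

/-- A homotopy that retracts a simply connected algebra onto a subspace with scalars in degree `0`
and nothing in degree `-1`. -/
lemma IsSimplyConnected.exists_homotopy (hsc : Ω.IsSimplyConnected) :
    ∃ h : A →ₗ[K] A, (∀ {i : ℤ} {a : A}, a ∈ 𝒜 i → h a ∈ 𝒜 (i + 1)) ∧ h 1 = 0 ∧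
      (∀ a ∈ 𝒜 0, ∃ c : K, homotopyProj Ω.d h a = c • 1) ∧
      ∀ a ∈ 𝒜 (-1), homotopyProj Ω.d h a = 0 := by
  -- `g₀` and `g₁` are partial inverses of `d` out of degrees `0` and `-1`.
  obtain ⟨g₀, hg₀⟩ := (Ω.d ∘ₗ (𝒜 0).subtype).exists_comp_comp_eq_self
  obtain ⟨g₁, hg₁⟩ := (Ω.d ∘ₗ (𝒜 (-1)).subtype).exists_comp_comp_eq_self
  have hproj : ∀ {i : ℤ} {a : A}, a ∈ 𝒜 i → ∀ j,
      GradedAlgebra.proj 𝒜 j a = if i = j then a else 0 := by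
    intro i a ha j
    rw [GradedAlgebra.proj_apply]
    split_ifs with hij
    · subst hij; exact DirectSum.decompose_of_mem_same 𝒜 ha
    · exact DirectSum.decompose_of_mem_ne 𝒜 ha hij
  -- On degree `-1`, `1 - g₁ d` takes values in the cycles, which are the image of `d`; hence
  -- `d g₀ (1 - g₁ d) + g₁ d = 1` there.
  let h : A →ₗ[K] A :=
    (𝒜 0).subtype ∘ₗ g₀ ∘ₗ (LinearMap.id - (𝒜 (-1)).subtype ∘ₗ g₁ ∘ₗ Ω.d) ∘ₗ
      GradedAlgebra.proj 𝒜 (-1) + (𝒜 (-1)).subtype ∘ₗ g₁ ∘ₗ GradedAlgebra.proj 𝒜 (-2)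
  have hval : ∀ a, h a = g₀ (GradedAlgebra.proj 𝒜 (-1) a -
      g₁ (Ω.d (GradedAlgebra.proj 𝒜 (-1) a))) + g₁ (GradedAlgebra.proj 𝒜 (-2) a) := fun a => rfl
  have h_zero : ∀ a ∈ 𝒜 0, h a = 0 := fun a ha => by
    rw [hval, hproj ha, hproj ha]; simp
  have h_one : ∀ a ∈ 𝒜 (-1), Ω.d (h a) + h (Ω.d a) = a := by
    intro a ha
    have hda : Ω.d a ∈ 𝒜 (-2) := Ω.d_mem ha
    rw [hval a, hval (Ω.d a), hproj ha, hproj ha, hproj hda, hproj hda, if_pos rfl, if_pos rfl,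
      if_neg (by norm_num), if_neg (by norm_num)]
    obtain ⟨v, hv, hdv⟩ := hsc.exists_d_eq (sub_mem ha (g₁ (Ω.d a)).2) (by
      rw [map_sub, sub_eq_zero]; exact (hg₁ ⟨a, ha⟩).symm)
    have h2 : Ω.d (g₀ (a - g₁ (Ω.d a))) = a - g₁ (Ω.d a) := by
      rw [← hdv]; exact hg₀ ⟨v, hv⟩
    simp only [map_zero, ZeroMemClass.coe_zero, sub_zero, zero_add, add_zero, h2, sub_add_cancel]
  refine ⟨h, fun {i a} ha => ?_, h_zero 1 (SetLike.one_mem_graded 𝒜), fun a ha => ?_,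
    fun a ha => ?_⟩
  · rw [hval, hproj ha, hproj ha]
    by_cases h1 : i = -1
    · subst h1
      rw [if_pos rfl, if_neg (by norm_num), map_zero, ZeroMemClass.coe_zero, add_zero]
      exact Subtype.prop _
    · by_cases h2 : i = -2
      · subst h2
        rw [if_neg (by norm_num), if_pos rfl]
        simp
      · rw [if_neg h1, if_neg h2]; simp
  · refine hsc.exists_smul_one ?_ ?_
    · rw [homotopyProj_apply, h_zero a ha, map_zero, zero_add]
      have hda : Ω.d a ∈ 𝒜 (-1) := Ω.d_mem ha
      have hdda : GradedAlgebra.proj 𝒜 (-2) (Ω.d a) = 0 := by rw [hproj hda, if_neg (by norm_num)]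
      rw [hval, hdda, map_zero, ZeroMemClass.coe_zero, add_zero]
      exact sub_mem ha (Subtype.prop _)
    · have := h_one (Ω.d a) (Ω.d_mem ha)
      rw [Ω.d_d, map_zero, add_zero] at this
      rw [homotopyProj_apply, h_zero a ha, map_zero, zero_add, map_sub, this, sub_self]
  · rw [homotopyProj_apply, h_one a ha, sub_self]

/-- The reduced Hochschild homology of a simply connected algebra vanishes in positive degrees: up
to multiplication of letters, which shortens words, `tensorHomotopy` contracts a chain onto words
without letters of degree `-1` whose letters of degree `0` are scalars, and these are degenerate in
positive degrees. -/
theorem IsSimplyConnected.exists_reducedCyclicBar_b_eq (hsc : Ω.IsSimplyConnected) {n : ℤ}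
    (hn : 0 < n) {x : Chains K A ⧸ unitChains K A} (hx : x ∈ Ω.reducedCyclicBar.gr n)
    (hb : Ω.reducedCyclicBar.b x = 0) :
    ∃ y ∈ Ω.reducedCyclicBar.gr (n + 1), Ω.reducedCyclicBar.b y = x := by
  obtain ⟨h, hh, h1, hp0, hp1⟩ := hsc.exists_homotopy
  set T := tensorHomotopy 𝒜 (homotopyProj Ω.d h) h with hT
  let H₁ : Chains K A →ₗ[K] Chains K A := (degen K A).mapQ (degen K A) T (tensorHomotopy_degen Ω h1)
  have hunit : unitChains K A ≤ (unitChains K A).comap H₁ := by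
    refine Submodule.span_le.2 ?_
    rintro _ rfl
    have h0 : T (natWord K 0 fun _ => 1) = 0 := by
      rw [hT, tensorHomotopy_natWord _ _ 0 _ (fun _ => 0) (fun _ => one_mem_parity)]
      simp [natWord_eq_zero (K := K) (k := 0) (j := 0) le_rfl
        (show homotopyLetters (homotopyProj Ω.d h) h 0 (fun _ : ℕ => (1 : A)) 0 = 0 by
          simp [homotopyLetters, h1])]
    change (degen K A).mkQ (T (natWord K 0 fun _ => 1)) ∈ unitChains K A
    rw [h0, map_zero]
    exact zero_mem _
  let H : (Chains K A ⧸ unitChains K A) →ₗ[K] (Chains K A ⧸ unitChains K A) :=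
    (unitChains K A).mapQ (unitChains K A) H₁ hunit
  let Q : Un K A →ₗ[K] (Chains K A ⧸ unitChains K A) := (unitChains K A).mkQ ∘ₗ (degen K A).mkQ
  have hgr : ∀ m, Ω.reducedCyclicBar.gr m = (unGr 𝒜 m).map Q := fun m =>
    (Submodule.map_comp _ _ _).symm
  have hQdegen : ∀ y ∈ degen K A, Q y = 0 := fun y hy => by
    change (unitChains K A).mkQ ((degen K A).mkQ y) = 0
    rw [Submodule.mkQ_apply (degen K A), (Submodule.Quotient.mk_eq_zero _).2 hy, map_zero]
  have hstep : ∀ k, unFil 𝒜 n (k + 1) ≤ (unFil 𝒜 n k ⊔ degen K A).comap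
      (LinearMap.id - (bUn 𝒜 Ω.d ∘ₗ T + T ∘ₗ bUn 𝒜 Ω.d)) := by
    intro k
    refine unFil_le fun m w e hm hw hsum => ?_
    have hmem := natWord_mem_unFil hm hw hsum
    have hbT := bMul_mem_unFil (tensorHomotopy_mem_unFil Ω hh hmem)
    have hTb := tensorHomotopy_mem_unFil Ω hh (bMul_mem_unFil hmem)
    rw [add_sub_cancel_right] at hbT
    rw [sub_add_cancel] at hTb
    have hdeg : natWord K m (fun j => homotopyProj Ω.d h (w j)) ∈ degen K A :=
      natWord_mem_degen_of_pos Ω hn (fun j => homotopyProj_mem Ω hh (hw j)) hsum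
        (fun j hj => hp0 _ (hj ▸ hw j)) (fun j hj => hp1 _ (hj ▸ hw j))
    have heq : (LinearMap.id - (bUn 𝒜 Ω.d ∘ₗ T + T ∘ₗ bUn 𝒜 Ω.d) : Un K A →ₗ[K] Un K A)
        (natWord K m w) = -(bMul 𝒜 (T (natWord K m w)) + T (bMul 𝒜 (natWord K m w))) +
          natWord K m (fun j => homotopyProj Ω.d h (w j)) := by
      have := bDiff_tensorHomotopy Ω hh m hw
      rw [← hT, ← eq_sub_iff_add_eq] at this
      simp only [LinearMap.sub_apply, LinearMap.add_apply, LinearMap.comp_apply, LinearMap.id_apply,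
        bUn, map_add, this]
      abel
    rw [Submodule.mem_comap, heq]
    exact add_mem (Submodule.mem_sup_left (neg_mem (add_mem hbT hTb)))
      (Submodule.mem_sup_right hdeg)
  refine Ω.reducedCyclicBar.exists_b_eq_of_filtration (fun k => (unFil 𝒜 n k).map Q) H
    ?_ ?_ ?_ ?_ ?_ ?_ hx hb
  · simp only [unFil_zero, Submodule.map_bot]
  · rw [hgr, ← Submodule.map_iSup]
    exact Submodule.map_mono (unGr_le_iSup_unFil n)
  · exact fun k l hkl => Submodule.map_mono (unFil_mono n hkl)
  · intro k
    rw [hgr]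
    exact Submodule.map_mono (unFil_le_unGr n k)
  · intro y hy
    rw [hgr] at hy ⊢
    obtain ⟨y, hy, rfl⟩ := hy
    exact ⟨T y, tensorHomotopy_mem Ω hh hy, rfl⟩
  · rintro k _ ⟨y, hy, rfl⟩
    obtain ⟨a, ha, c, hc, hac⟩ := Submodule.mem_sup.1 (hstep k hy)
    refine ⟨a, ha, ?_⟩
    have := congrArg Q hac
    rw [map_add, hQdegen c hc, add_zero] at this
    rw [this]
    rfl

end NonposCDGA

/-! ### The characterisation of BV exactness -/

theorem mainTheorem3 {K : Type*} [Field K] [CharZero K] {A : Type*} [Ring A] [Algebra K A]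
    (𝒜 : ℤ → Submodule K A) [GradedAlgebra 𝒜] (Ω : NonposCDGA 𝒜)
    (hsc : Ω.IsSimplyConnected) (hfin : Ω.IsLocallyFinite) :
    Ω.IsBVExact ↔ ∀ n : ℤ, Ω.reducedS n = 0 :=
  ⟨fun hB => Ω.reducedCyclicBar.S_eq_zero_of_range_connesB_eq_ker
      (fun _ hn _ hx hb => hsc.exists_reducedCyclicBar_b_eq hn hx hb) hB,
    fun hS => Ω.reducedCyclicBar.range_connesB_eq_ker_of_S_eq_zero hS⟩
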